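/- Let $\mathbb T^2=\mathbb R^2/\mathbb Z^2$ with standard coordinates $(x,y)$. For a Finsler metric $F$ on $\mathbb T^2$ (continuous on $T\mathbb T^2$, smooth off the zero section, positively homogeneous, positive definite and strongly convex, but not necessarily reversible) let $\pi\colon H\mathbb T^2=(T\mathbb T^2\smallsetminus 0)/\mathbb R^+\to\mathbb T^2$ be the bundle of oriented tangent directions. Let $A$ be the Hilbert form of $F$, i.e. the $1$-form on $H\mathbb T^2$ given at the direction of $v\in T_p\mathbb T^2$ by $A(Z)=\frac{d}{d\varepsilon}\big|_{\varepsilon=0}F(p,v+\varepsilon\,d\pi(Z))$, and let $X$ be its Reeb field, defined by $A(X)=1$, $i_X\,dA=0$. Let $\Omega^F$ be the volume form on $\mathbb T^2$ and $\alpha^F$ the angle $1$-form on $H\mathbb T^2$ (determined on vertical vectors) such that $\alpha^F\wedge\pi^*\Omega^F=A\wedge dA$ and $\int_{H_p\mathbb T^2}\alpha^F=2\pi$ for every $p$. The volume of $(\mathbb T^2,F)$ is the total mass of $\Omega^F$, and the Finsler--Laplacian is $$\Delta^F f(p)=\frac1\pi\int_{H_p\mathbb T^2}L_X^2(\pi^*f)\,\alpha^F,\qquad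 f\in C^2(\mathbb T^2).$$ Let $0=\lambda_0(F)\le\lambda_1(F)\le\dots$ be the eigenvalues of $-\Delta^F$, counted with multiplicity. Let $h>1$ and $g_0=h^2\,dx^2+h^{-2}\,dy^2$, and for $0\le\eta<1$ put $F_\eta=\sqrt{g_0}+\eta h\,dx$. Then for every $0\le\eta<1$ the function $F_\eta$ is a Randers metric, that is, the $1$-form $\eta h\,dx$ has norm less than $1$ for the dual metric of $g_0$; it is a Finsler metric, and the volume of $(\mathbb T^2,F_\eta)$ is $1$. Moreover, there is $\eta_0<1$, depending on $h$, such that for all $\eta\in[0,1)$ with $\eta>\eta_0$ $$\lambda_1(F_\eta)\ge 4\pi^2h^2.$$ -/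

import Mathlib

open scoped ContDiff Matrix

noncomputable section

namespace FinslerTorus

/-- The torus `ℝ² / ℤ²`. -/
abbrev T2 : Type := UnitAddTorus (Fin 2)

/-- The plane: the universal cover of the torus, and also each of its tangent spaces
(the tangent bundle is trivialised by the standard coordinates). -/
abbrev Plane : Type := Fin 2 → ℝ

/-- The covering projection `ℝ² → ℝ² / ℤ²`. -/
def proj (p : Plane) : T2 := fun i => (p i : UnitAddCircle)

/-! ### Finsler and Randers metrics -/

/-- Finsler metrics on the torus. A function on the tangent bundle is `F x v`, with `x` a point
of the torus and `v` a tangent vector at `x` in the standard coordinates. -/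
structure IsFinslerMetric (F : T2 → Plane → ℝ) : Prop where
  continuous : Continuous fun q : T2 × Plane => F q.1 q.2
  smooth : ContDiffOn ℝ ∞ (fun q : Plane × Plane => F (proj q.1) q.2) {q | q.2 ≠ 0}
  homogeneous : ∀ (x : T2) (v : Plane) (c : ℝ), 0 < c → F x (c • v) = c * F x v
  nonneg : ∀ (x : T2) (v : Plane), 0 ≤ F x v
  eq_zero_iff : ∀ (x : T2) (v : Plane), F x v = 0 ↔ v = 0
  strongly_convex : ∀ (x : T2) (v w : Plane), v ≠ 0 → w ≠ 0 →
    0 < fderiv ℝ (fderiv ℝ fun u : Plane => F x u ^ 2) v w w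

/-- The function `√g + ρ` on the tangent bundle, for a field `g` of symmetric matrices and a
`1`-form `ρ` (given by its components). -/
def randers (g : T2 → Matrix (Fin 2) (Fin 2) ℝ) (ρ : T2 → Plane) (x : T2) (v : Plane) : ℝ :=
  √(v ⬝ᵥ (g x *ᵥ v)) + ρ x ⬝ᵥ v

/-- Randers metrics: `F = √g + ρ` with `g` a smooth Riemannian metric and `ρ` a smooth `1`-form
whose norm for the dual metric `g⁻¹` is everywhere less than `1`. -/
def IsRandersMetric (F : T2 → Plane → ℝ) : Prop :=
  ∃ (g : T2 → Matrix (Fin 2) (Fin 2) ℝ) (ρ : T2 → Plane),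
    (∀ i j, ContDiff ℝ ∞ fun p : Plane => g (proj p) i j) ∧
    (∀ i, ContDiff ℝ ∞ fun p : Plane => ρ (proj p) i) ∧
    (∀ x, (g x).PosDef) ∧
    (∀ x, √(ρ x ⬝ᵥ ((g x)⁻¹ *ᵥ ρ x)) < 1) ∧
    F = randers g ρ

/-! ### The homogenized bundle and the Hilbert form

The homogenized bundle `HM` (nonzero tangent vectors up to positive scaling) of the torus is
`T² × S¹`. Its points are written in coordinates `((x, y), θ)`, which stand for the base point
`(x, y)` mod `ℤ²` and the ray spanned by `(cos θ, sin θ)`; objects on `HM` are given by their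
pull-backs to this universal cover. -/

/-- The universal cover of the homogenized bundle. -/
abbrev HPlane : Type := Plane × ℝ

/-- The representative `(cos θ, sin θ)` of a direction. -/
def dir (θ : ℝ) : Plane := ![Real.cos θ, Real.sin θ]

/-- The Hilbert form: `A(Z) = lim (F(x, v + ε dπ(Z)) - F(x, v)) / ε`, where `v` represents the
direction and `π` is the projection to the base. -/
def hilbertForm (F : T2 → Plane → ℝ) (q : HPlane) : HPlane →L[ℝ] ℝ :=
  (fderiv ℝ (F (proj q.1)) (dir q.2)).comp (ContinuousLinearMap.fst ℝ Plane ℝ)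

/-- The exterior derivative `dA` of the Hilbert form. -/
def dHilbertForm (F : T2 → Plane → ℝ) : HPlane → HPlane [⋀^Fin 2]→L[ℝ] ℝ :=
  extDeriv fun q => ContinuousAlternatingMap.ofSubsingleton ℝ HPlane ℝ (0 : Fin 1) (hilbertForm F q)

/-- The `3`-form `A ∧ dA`, evaluated on three tangent vectors. -/
def contactVolume (F : T2 → Plane → ℝ) (q u v w : HPlane) : ℝ :=
  hilbertForm F q u * dHilbertForm F q ![v, w] + hilbertForm F q v * dHilbertForm F q ![w, u] +
    hilbertForm F q w * dHilbertForm F q ![u, v]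

/-- The coordinate vector field `∂/∂x`. -/
def ex : HPlane := (![1, 0], 0)

/-- The coordinate vector field `∂/∂y`. -/
def ey : HPlane := (![0, 1], 0)

/-- The coordinate vector field `∂/∂θ`, which spans the vertical bundle. -/
def eθ : HPlane := (0, 1)

/-- The Reeb field of `A`: the vector field with `A(X) = 1` and `i_X dA = 0`
(it exists and is unique when `F` is a Finsler metric). -/
def reeb (F : T2 → Plane → ℝ) (q : HPlane) : HPlane :=
  Classical.epsilon fun X => hilbertForm F q X = 1 ∧ ∀ w, dHilbertForm F q ![X, w] = 0

/-! ### Volume and angle forms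

The forms `Ω` on the torus and `α` on `HM` are determined by `α ∧ π^*Ω = A ∧ dA` and
`∫_{H_x M} α = 2π`, the fibre being oriented by increasing `θ`. Writing `Ω = ω dx ∧ dy` and
`a = α(∂/∂θ)`, the first equation reads `a ω = (A ∧ dA)(∂/∂θ, ∂/∂x, ∂/∂y)`. -/

/-- The component `ω` of the volume form `Ω = ω dx ∧ dy`. -/
def volumeForm (F : T2 → Plane → ℝ) (p : Plane) : ℝ :=
  (2 * Real.pi)⁻¹ * ∫ θ in (0 : ℝ)..(2 * Real.pi), contactVolume F (p, θ) eθ ex ey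

/-- The component `α(∂/∂θ)` of the angle form. -/
def angleForm (F : T2 → Plane → ℝ) (q : HPlane) : ℝ :=
  contactVolume F q eθ ex ey / volumeForm F q.1

/-- The two defining equations leave no other choice for `Ω` and for `α` on vertical vectors. -/
theorem volumeForm_angleForm_unique (F : T2 → Plane → ℝ) (p : Plane) (m : ℝ) (a : ℝ → ℝ)
    (hm : m ≠ 0) (h : ∀ θ, a θ * m = contactVolume F (p, θ) eθ ex ey)
    (ha : ∫ θ in (0 : ℝ)..(2 * Real.pi), a θ = 2 * Real.pi) :
    m = volumeForm F p ∧ ∀ θ, a θ = angleForm F (p, θ) := by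
  have h1 : m = volumeForm F p := by
    have hpi := Real.pi_ne_zero
    simp only [volumeForm, ← h, intervalIntegral.integral_mul_const, ha]
    field_simp
  refine ⟨h1, fun θ => ?_⟩
  simp only [angleForm, ← h, ← h1]
  field_simp

/-- The total volume of the torus, the integral of `|Ω|` over a fundamental domain. -/
def totalVolume (F : T2 → Plane → ℝ) : ℝ :=
  ∫ p in Set.Icc (0 : Plane) 1, |volumeForm F p|

/-! ### The Finsler-Laplacian and its spectrum -/

/-- The Lie derivative along the Reeb field of a function on the homogenized bundle. -/
def lieReeb (F : T2 → Plane → ℝ) (φ : HPlane → ℝ) (q : HPlane) : ℝ :=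
  fderiv ℝ φ q (reeb F q)

/-- The Finsler-Laplacian `Δ f (x) = n / vol(S^{n-1}) ∫_{H_x M} L_X² (π^* f) α` for `n = 2`. -/
def laplacian (F : T2 → Plane → ℝ) (f : T2 → ℝ) (p : Plane) : ℝ :=
  2 / (2 * Real.pi) * ∫ θ in (0 : ℝ)..(2 * Real.pi),
    lieReeb F (lieReeb F fun q => f (proj q.1)) (p, θ) * angleForm F (p, θ)

/-- `f` is an eigenfunction of `-Δ` for the eigenvalue `μ`. -/
def IsEigenfunction (F : T2 → Plane → ℝ) (μ : ℝ) (f : T2 → ℝ) : Prop :=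
  (ContDiff ℝ 2 fun p => f (proj p)) ∧ f ≠ 0 ∧ ∀ p, -laplacian F f p = μ * f (proj p)

/-- `lam` is the `k`-th eigenvalue of `-Δ` in the list `0 = λ₀ ≤ λ₁ ≤ λ₂ ≤ ⋯` in which every
eigenvalue is repeated according to its multiplicity: the least number such that there are
`k + 1` linearly independent eigenfunctions with eigenvalues at most `lam`. -/
def IsKthEigenvalue (F : T2 → Plane → ℝ) (k : ℕ) (lam : ℝ) : Prop :=
  IsLeast {t : ℝ | ∃ f : Fin (k + 1) → T2 → ℝ, LinearIndependent ℝ f ∧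
    ∀ i, ∃ μ ≤ t, IsEigenfunction F μ (f i)} lam

/-! ### The example -/

/-- The Randers metric `√g₀ + η h dx` with `g₀ = diag(h², h⁻²)`. -/
def torusRanders (h η : ℝ) : T2 → Plane → ℝ :=
  randers (fun _ => !![h ^ 2, 0; 0, h⁻¹ ^ 2]) (fun _ => ![η * h, 0])

end FinslerTorus

end

/-!
For a translation-invariant Finsler metric `F = φ` write `K` for the second derivative of `φ` at the
direction `dir θ` along its normal. Since `φ` is homogeneous, `dA` involves the Hessian of `φ` only
through `K`: the volume `A ∧ dA` is `-φ K` times the standard one, the Reeb field at `dir θ` is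
`φ⁻¹ • dir θ`, and `Δ f` is up to a constant the integral of `D²f (dir θ, dir θ) * K / φ`, so `Δ` is
an operator with constant coefficients.

For `F_η` we have `K = ‖dir θ‖⁻³`, the norm being that of `g₀`. Passing to the polar angle `ψ` of a
`g₀`-orthonormal frame turns the integral into that of `D²f (u, u) / (1 + η cos ψ)` over the
`g₀`-unit vectors `u`, so that `Δ = c₀ ∂ₓ² + c₁ ∂ᵧ²` with, for `s = √(1 - η²)`,
`c₀ = 2 / (h² s (1 + s))` and `c₁ = 2 h² / (1 + s)`. Fourier series give `λ₁ = 4π² min (c₀, c₁)`.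
Always `c₁ ≥ h²`, while `c₀` tends to infinity as `η` tends to `1`.
-/

noncomputable section

namespace FinslerTorus

open scoped Real

/-! ### Fourier coefficients and partial derivatives on the torus -/

section Fourier

open MeasureTheory UnitAddTorus

variable {d : Type*} [Fintype d]

theorem mFourier_apply_add (n : d → ℤ) (x y : UnitAddTorus d) :
    mFourier n (x + y) = mFourier n x * mFourier n y := by
  simp [mFourier, fourier_apply, AddCircle.toCircle_add, smul_add, Finset.prod_mul_distrib]

theorem mFourier_single [DecidableEq d] (n : d → ℤ) (i : d) (t : UnitAddCircle) :
    mFourier n (Pi.single i t) = fourier (n i) t := by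
  rw [mFourier, ContinuousMap.coe_mk, Fintype.prod_eq_single i, Pi.single_eq_same]
  intro j hj
  rw [Pi.single_eq_of_ne hj, fourier_eval_zero]

/-- The Haar probability measure of the torus, with respect to which the Fourier coefficients
`mFourierCoeff` are defined. -/
abbrev torusHaar (d : Type*) [Fintype d] : Measure (UnitAddTorus d) :=
  Measure.pi fun _ => AddCircle.haarAddCircle

theorem mFourierCoeff_eq_integral (g : UnitAddTorus d → ℂ) (n : d → ℤ) :
    mFourierCoeff g n = ∫ x, mFourier (-n) x * g x ∂torusHaar d := rfl

theorem integrable_torusHaar {g : UnitAddTorus d → ℂ} (hg : Continuous g) :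
    Integrable g (torusHaar d) :=
  hg.integrable_of_hasCompactSupport (HasCompactSupport.of_compactSpace g)

theorem mFourierCoeff_comp_add_right (g : UnitAddTorus d → ℂ) (n : d → ℤ) (y : UnitAddTorus d) :
    mFourierCoeff (fun x => g (x + y)) n = mFourier n y * mFourierCoeff g n := by
  have inv_mul (x : UnitAddTorus d) : mFourier n x * mFourier (-n) x = 1 := by
    rw [← mFourier_add, add_neg_cancel, mFourier_zero, ContinuousMap.one_apply]
  rw [mFourierCoeff_eq_integral, mFourierCoeff_eq_integral, ← integral_const_mul,
    ← integral_add_right_eq_self (fun x => mFourier n y * (mFourier (-n) x * g x)) y]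
  refine integral_congr_ae (.of_forall fun x => ?_)
  simp only [mFourier_apply_add]
  linear_combination (-mFourier (-n) x * g (x + y)) * inv_mul y

theorem hasDerivAt_mFourierCoeff_comp_add_right [DecidableEq d] {g g' : UnitAddTorus d → ℂ}
    (hg : Continuous g) (hg' : Continuous g') {i : d}
    (h : ∀ x, HasDerivAt (fun s : ℝ => g (x + Pi.single i (s : UnitAddCircle))) (g' x) 0)
    (n : d → ℤ) :
    HasDerivAt (fun s : ℝ => mFourierCoeff (fun x => g (x + Pi.single i (s : UnitAddCircle))) n)
      (mFourierCoeff g' n) 0 := by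
  have deriv_at (x : UnitAddTorus d) (s : ℝ) :
      HasDerivAt (fun s : ℝ => g (x + Pi.single i (s : UnitAddCircle)))
        (g' (x + Pi.single i (s : UnitAddCircle))) s := by
    have hx := h (x + Pi.single i (s : UnitAddCircle))
    rw [← sub_self s] at hx
    refine (hx.comp_sub_const s s).congr_of_eventuallyEq (.of_forall fun t => ?_)
    simp [add_assoc, ← Pi.single_add]
  obtain ⟨C, hC⟩ := isCompact_univ.exists_bound_of_continuousOn hg'.continuousOn
  have diff_integral := (hasDerivAt_integral_of_dominated_loc_of_deriv_le
    (μ := torusHaar d) (x₀ := (0 : ℝ)) (s := Set.univ) (bound := fun _ => C)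
    (F := fun (s : ℝ) (x : UnitAddTorus d) =>
      mFourier (-n) x * g (x + Pi.single i (s : UnitAddCircle)))
    (F' := fun (s : ℝ) (x : UnitAddTorus d) =>
      mFourier (-n) x * g' (x + Pi.single i (s : UnitAddCircle)))
    Filter.univ_mem (.of_forall fun s => Continuous.aestronglyMeasurable (by fun_prop))
    (integrable_torusHaar (by fun_prop)) (Continuous.aestronglyMeasurable (by fun_prop))
    (.of_forall fun x s _ => ?_) (integrable_const C)
    (.of_forall fun x s _ => (deriv_at x s).const_mul _)).2
  · simpa [mFourierCoeff_eq_integral] using diff_integral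
  · have unit_bound := (mFourier (-n)).norm_coe_le_norm x
    rw [mFourier_norm] at unit_bound
    rw [norm_mul]
    exact (mul_le_of_le_one_left (norm_nonneg _) unit_bound).trans (hC _ (Set.mem_univ _))

theorem mFourierCoeff_of_hasDerivAt [DecidableEq d] {g g' : UnitAddTorus d → ℂ}
    (hg : Continuous g) (hg' : Continuous g') {i : d}
    (h : ∀ x, HasDerivAt (fun s : ℝ => g (x + Pi.single i (s : UnitAddCircle))) (g' x) 0)
    (n : d → ℤ) :
    mFourierCoeff g' n = 2 * π * Complex.I * n i * mFourierCoeff g n := by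
  have lhs := hasDerivAt_mFourierCoeff_comp_add_right hg hg' h n
  have rhs := (hasDerivAt_fourier 1 (n i) 0).mul_const (mFourierCoeff g n)
  simp only [mFourierCoeff_comp_add_right, mFourier_single] at lhs
  simpa using lhs.unique rhs

theorem eq_mFourierCoeff_zero_of_forall_ne {g : UnitAddTorus d → ℂ} (hg : Continuous g)
    (h : ∀ n ≠ 0, mFourierCoeff g n = 0) (x : UnitAddTorus d) : g x = mFourierCoeff g 0 := by
  let G : C(UnitAddTorus d, ℂ) := ⟨g, hg⟩
  have summable_coeff : Summable (mFourierCoeff G) :=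
    summable_of_ne_finset_zero (s := {0}) fun n hn => h n (by simpa using hn)
  have single_term := hasSum_single (f := fun n => mFourierCoeff G n • mFourier n x) 0
    fun n hn => by rw [show mFourierCoeff G n = 0 from h n hn, zero_smul]
  simpa [mFourier_zero, G] using
    (hasSum_mFourier_series_apply_of_summable summable_coeff x).unique single_term

theorem lt_sum_mul_sq_of_forall_lt {c : d → ℝ} (hc : ∀ i, 0 ≤ c i) {μ : ℝ} (hμ : ∀ i, μ < c i)
    {n : d → ℤ} (hn : n ≠ 0) : μ < ∑ i, c i * (n i : ℝ) ^ 2 := by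
  obtain ⟨i, hi⟩ := Function.ne_iff.1 hn
  have one_le : (1 : ℝ) ≤ (n i : ℝ) ^ 2 := by
    exact_mod_cast (one_le_sq_iff_one_le_abs (n i)).2 (Int.one_le_abs hi)
  calc
    μ < c i := hμ i
    _ ≤ c i * (n i : ℝ) ^ 2 := le_mul_of_one_le_right (hc i) one_le
    _ ≤ ∑ i, c i * (n i : ℝ) ^ 2 := Finset.single_le_sum
      (f := fun i => c i * (n i : ℝ) ^ 2) (fun j _ => mul_nonneg (hc j) (sq_nonneg _))
      (Finset.mem_univ i)

theorem exists_eq_const_of_eigenvalue_lt [DecidableEq d] {c : d → ℝ} (hc : ∀ i, 0 ≤ c i) {μ : ℝ}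
    (hμ : ∀ i, μ < 4 * π ^ 2 * c i) {f : UnitAddTorus d → ℝ}
    {f₁ f₂ : d → UnitAddTorus d → ℝ}
    (hf : Continuous f) (hf₁ : ∀ i, Continuous (f₁ i)) (hf₂ : ∀ i, Continuous (f₂ i))
    (hff₁ : ∀ i x, HasDerivAt (fun s : ℝ => f (x + Pi.single i (s : UnitAddCircle))) (f₁ i x) 0)
    (hf₁f₂ : ∀ i x,
      HasDerivAt (fun s : ℝ => f₁ i (x + Pi.single i (s : UnitAddCircle))) (f₂ i x) 0)
    (heq : ∀ x, -∑ i, c i * f₂ i x = μ * f x) : ∃ a, ∀ x, f x = a := by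
  set a : (d → ℤ) → ℂ := mFourierCoeff fun x => (f x : ℂ)
  suffices coeff_zero : ∀ n ≠ 0, a n = 0 by
    refine ⟨(a 0).re, fun x => ?_⟩
    exact congrArg Complex.re (eq_mFourierCoeff_zero_of_forall_ne (by fun_prop) coeff_zero x)
  intro n hn
  have second_coeff (i : d) :
      mFourierCoeff (fun x => (f₂ i x : ℂ)) n = -(4 * π ^ 2 * (n i) ^ 2) * a n := by
    rw [mFourierCoeff_of_hasDerivAt (g := fun x => (f₁ i x : ℂ)) (by fun_prop) (by fun_prop)
        fun x => (hf₁f₂ i x).ofReal_comp,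
      mFourierCoeff_of_hasDerivAt (g := fun x => (f x : ℂ)) (by fun_prop) (by fun_prop)
        fun x => (hff₁ i x).ofReal_comp]
    linear_combination (4 * π ^ 2 * (n i : ℂ) ^ 2 * a n) * Complex.I_sq
  have coeff_eq : -∑ i, (c i : ℂ) * mFourierCoeff (fun x => (f₂ i x : ℂ)) n = μ * a n := by
    simp only [a, mFourierCoeff_eq_integral, ← integral_const_mul]
    rw [← integral_finsetSum _ fun i _ => integrable_torusHaar (by fun_prop), ← integral_neg]
    refine integral_congr_ae (.of_forall fun x => ?_)
    have heq' : -∑ i, (c i : ℂ) * (f₂ i x : ℂ) = μ * (f x : ℂ) := by exact_mod_cast heq x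
    simp only [mul_left_comm _ (mFourier (-n) x), ← Finset.mul_sum]
    linear_combination mFourier (-n) x * heq'
  have factor : ((∑ i, 4 * π ^ 2 * c i * (n i : ℝ) ^ 2 - μ : ℝ) : ℂ) * a n = 0 := by
    push_cast
    rw [sub_mul, ← coeff_eq, sub_neg_eq_add, Finset.sum_mul, ← Finset.sum_add_distrib]
    exact Finset.sum_eq_zero fun i _ => by rw [second_coeff]; ring
  refine (mul_eq_zero.1 factor).resolve_left (Complex.ofReal_ne_zero.2 (ne_of_gt (sub_pos.2 ?_)))
  exact lt_sum_mul_sq_of_forall_lt (fun i => mul_nonneg (by positivity) (hc i)) hμ hn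

end Fourier

theorem proj_add_single (p : Plane) (i : Fin 2) (s : ℝ) :
    proj (p + Pi.single i s) = proj p + Pi.single i (s : UnitAddCircle) := by
  ext j
  rcases eq_or_ne j i with rfl | hj
  · simp [proj]
  · simp [proj, hj]

theorem isOpenQuotientMap_proj : IsOpenQuotientMap proj :=
  .piMap fun _ => QuotientAddGroup.isOpenQuotientMap_mk

theorem continuous_of_continuous_comp_proj {X : Type*} [TopologicalSpace X] {g : T2 → X}
    (hg : Continuous fun p => g (proj p)) : Continuous g :=
  isOpenQuotientMap_proj.continuous_comp_iff.1 hg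

/-- The partial derivative in the `i`-th coordinate of a function on the torus. -/
def partialDeriv (i : Fin 2) (g : T2 → ℝ) (x : T2) : ℝ :=
  deriv (fun s : ℝ => g (x + Pi.single i (s : UnitAddCircle))) 0

section PartialDeriv

variable {g : T2 → ℝ} (i : Fin 2)

theorem hasDerivAt_proj_add_single {p : Plane}
    (hg : DifferentiableAt ℝ (fun p => g (proj p)) p) :
    HasDerivAt (fun s : ℝ => g (proj p + Pi.single i (s : UnitAddCircle)))
      (fderiv ℝ (fun p => g (proj p)) p (Pi.single i 1)) 0 := by
  have line := (hasDerivAt_single i (0 : ℝ)).const_add p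
  rw [← add_zero p, ← Pi.single_zero i] at hg
  simpa [Function.comp_def, proj_add_single] using hg.hasFDerivAt.comp_hasDerivAt 0 line

theorem partialDeriv_proj {p : Plane} (hg : DifferentiableAt ℝ (fun p => g (proj p)) p) :
    partialDeriv i g (proj p) = fderiv ℝ (fun p => g (proj p)) p (Pi.single i 1) :=
  (hasDerivAt_proj_add_single i hg).deriv

theorem hasDerivAt_partialDeriv (hg : Differentiable ℝ fun p => g (proj p)) (x : T2) :
    HasDerivAt (fun s : ℝ => g (x + Pi.single i (s : UnitAddCircle))) (partialDeriv i g x) 0 := by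
  obtain ⟨p, rfl⟩ := isOpenQuotientMap_proj.surjective x
  exact partialDeriv_proj i (hg p) ▸ hasDerivAt_proj_add_single i (hg p)

theorem contDiff_partialDeriv {m n : ℕ∞ω} (hg : ContDiff ℝ n fun p => g (proj p))
    (hmn : m + 1 ≤ n) : ContDiff ℝ m fun p => partialDeriv i g (proj p) := by
  have hd : Differentiable ℝ fun p => g (proj p) :=
    hg.differentiable (ne_of_gt (lt_of_lt_of_le (by simp) hmn))
  simp only [fun p => partialDeriv_proj i (hd p)]
  exact (hg.fderiv_right hmn).clm_apply contDiff_const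

theorem partialDeriv_partialDeriv_proj (hg : ContDiff ℝ 2 fun p => g (proj p)) (p : Plane) :
    partialDeriv i (partialDeriv i g) (proj p) =
      fderiv ℝ (fderiv ℝ fun p => g (proj p)) p (Pi.single i 1) (Pi.single i 1) := by
  have hd : Differentiable ℝ fun p => g (proj p) := hg.differentiable two_ne_zero
  have hd' : Differentiable ℝ (fderiv ℝ fun p => g (proj p)) :=
    (hg.fderiv_right (m := 1) one_add_one_eq_two.le).differentiable one_ne_zero
  have hd₁ : Differentiable ℝ fun p => partialDeriv i g (proj p) :=
    (contDiff_partialDeriv i (m := 1) hg one_add_one_eq_two.le).differentiable one_ne_zero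
  rw [partialDeriv_proj i (hd₁ p)]
  simp only [fun p => partialDeriv_proj i (hd p)]
  rw [fderiv_clm_apply (hd' p) (differentiableAt_const _)]
  simp

end PartialDeriv

theorem exists_eq_const_of_eigenvalue_lt_proj {c : Fin 2 → ℝ} (hc : ∀ i, 0 ≤ c i) {μ : ℝ}
    (hμ : ∀ i, μ < 4 * π ^ 2 * c i) {f : T2 → ℝ} (hf : ContDiff ℝ 2 fun p => f (proj p))
    (heq : ∀ p, -∑ i, c i *
      fderiv ℝ (fderiv ℝ fun p => f (proj p)) p (Pi.single i 1) (Pi.single i 1) = μ * f (proj p)) :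
    ∃ a, ∀ x, f x = a := by
  have hf₁ (i : Fin 2) : ContDiff ℝ 1 fun p => partialDeriv i f (proj p) :=
    contDiff_partialDeriv i hf one_add_one_eq_two.le
  have hf₂ (i : Fin 2) : ContDiff ℝ 0 fun p => partialDeriv i (partialDeriv i f) (proj p) :=
    contDiff_partialDeriv i (hf₁ i) (zero_add 1).le
  refine exists_eq_const_of_eigenvalue_lt hc hμ
    (continuous_of_continuous_comp_proj hf.continuous)
    (fun i => continuous_of_continuous_comp_proj (hf₁ i).continuous)
    (fun i => continuous_of_continuous_comp_proj (hf₂ i).continuous)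
    (fun i => hasDerivAt_partialDeriv i (hf.differentiable two_ne_zero))
    (fun i => hasDerivAt_partialDeriv i ((hf₁ i).differentiable one_ne_zero)) fun x => ?_
  obtain ⟨p, rfl⟩ := isOpenQuotientMap_proj.surjective x
  simpa only [partialDeriv_partialDeriv_proj _ hf] using heq p

/-! ### Homogeneous functions and Randers norms -/

section PosHomogeneous

open Filter Topology

variable {E : Type*} [NormedAddCommGroup E] [NormedSpace ℝ E] {φ : E → ℝ} {v : E}

theorem fderiv_apply_self_of_posHomogeneous
    (hom : ∀ (v : E) (c : ℝ), 0 < c → φ (c • v) = c * φ v) (hφ : DifferentiableAt ℝ φ v) :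
    fderiv ℝ φ v v = φ v := by
  have ray : HasDerivAt (fun t : ℝ => t • v) v 1 := by
    simpa using (hasDerivAt_id' (1 : ℝ)).smul_const v
  have along_ray : HasDerivAt (fun t : ℝ => φ (t • v)) (fderiv ℝ φ v v) 1 := by
    rw [← one_smul ℝ v] at hφ
    simpa [Function.comp_def] using hφ.hasFDerivAt.comp_hasDerivAt 1 ray
  have linear : HasDerivAt (fun t : ℝ => t * φ v) (φ v) 1 := by
    simpa using (hasDerivAt_id' (1 : ℝ)).mul_const (φ v)
  refine along_ray.unique (linear.congr_of_eventuallyEq ?_)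
  filter_upwards [lt_mem_nhds one_pos] with t ht using hom v t ht

theorem differentiableAt_fderiv_of_contDiffAt (hφ : ContDiffAt ℝ 2 φ v) :
    DifferentiableAt ℝ (fderiv ℝ φ) v :=
  (hφ.fderiv_right (m := 1) one_add_one_eq_two.le).differentiableAt one_ne_zero

theorem eventually_differentiableAt_of_contDiffAt (hφ : ContDiffAt ℝ 2 φ v) :
    ∀ᶠ u in 𝓝 v, DifferentiableAt ℝ φ u := by
  filter_upwards [hφ.eventually (by simp)] with u hu using hu.differentiableAt two_ne_zero

theorem fderiv_fderiv_apply_self_of_posHomogeneous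
    (hom : ∀ (v : E) (c : ℝ), 0 < c → φ (c • v) = c * φ v) (hφ : ContDiffAt ℝ 2 φ v) (w : E) :
    fderiv ℝ (fderiv ℝ φ) v w v = 0 := by
  have euler : (fun u => fderiv ℝ φ u u) =ᶠ[𝓝 v] φ := by
    filter_upwards [eventually_differentiableAt_of_contDiffAt hφ] with u hu
      using fderiv_apply_self_of_posHomogeneous hom hu
  have deriv_euler := DFunLike.congr_fun (euler.fderiv_eq (𝕜 := ℝ)) w
  rw [fderiv_clm_apply (differentiableAt_fderiv_of_contDiffAt hφ) differentiableAt_fun_id]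
    at deriv_euler
  simpa using deriv_euler

theorem fderiv_fderiv_sq (hφ : ContDiffAt ℝ 2 φ v) (w : E) :
    fderiv ℝ (fderiv ℝ fun u => φ u ^ 2) v w w =
      2 * (fderiv ℝ φ v w ^ 2 + φ v * fderiv ℝ (fderiv ℝ φ) v w w) := by
  have first : (fderiv ℝ fun u => φ u ^ 2) =ᶠ[𝓝 v] fun u => (2 * φ u) • fderiv ℝ φ u := by
    filter_upwards [eventually_differentiableAt_of_contDiffAt hφ] with u hu
    rw [fderiv_fun_pow 2 hu]
    simp only [Nat.add_one_sub_one, pow_one, nsmul_eq_mul, Nat.cast_ofNat]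
  rw [first.fderiv_eq, fderiv_fun_smul ((hφ.differentiableAt two_ne_zero).const_mul 2)
    (differentiableAt_fderiv_of_contDiffAt hφ),
    fderiv_const_mul (hφ.differentiableAt two_ne_zero)]
  simp only [add_apply, smul_apply, ContinuousLinearMap.smulRight_apply, smul_eq_mul]
  ring

/-- The Hessian of `φ` is degenerate along `v`, where it is the square of the differential that
makes the Hessian of `φ ^ 2` positive. -/
theorem fderiv_fderiv_sq_pos_of_posHomogeneous
    (hom : ∀ (v : E) (c : ℝ), 0 < c → φ (c • v) = c * φ v) (hφ : ContDiffAt ℝ 2 φ v)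
    (hv : v ≠ 0) (hφv : 0 < φ v)
    (transversal : ∀ w, LinearIndependent ℝ ![v, w] → 0 < fderiv ℝ (fderiv ℝ φ) v w w)
    {w : E} (hw : w ≠ 0) : 0 < fderiv ℝ (fderiv ℝ fun u => φ u ^ 2) v w w := by
  rw [fderiv_fderiv_sq hφ]
  by_cases hvw : LinearIndependent ℝ ![v, w]
  · have := transversal w hvw
    positivity
  · obtain ⟨c, rfl⟩ : ∃ c : ℝ, c • v = w := by
      simpa [LinearIndependent.pair_iff' hv] using hvw
    have hc : c ≠ 0 := fun hc => hw (by rw [hc, zero_smul])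
    rw [map_smul, map_smul, fderiv_fderiv_apply_self_of_posHomogeneous hom hφ,
      fderiv_apply_self_of_posHomogeneous hom (hφ.differentiableAt two_ne_zero), smul_zero,
      mul_zero, add_zero, smul_eq_mul]
    positivity

end PosHomogeneous

section RandersNorm

open Filter Topology

variable {E : Type*} [NormedAddCommGroup E] [NormedSpace ℝ E]
  {B : E →L[ℝ] E →L[ℝ] ℝ} {v : E}

/-- The function `√(B v v) + ℓ v` on a vector space, for a bilinear form `B` and a linear form `ℓ`:
the restriction of a Randers metric to one tangent space. -/
def randersNorm (B : E →L[ℝ] E →L[ℝ] ℝ) (ℓ : E →L[ℝ] ℝ) (v : E) : ℝ := √(B v v) + ℓ v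

theorem randersNorm_smul (B : E →L[ℝ] E →L[ℝ] ℝ) (ℓ : E →L[ℝ] ℝ) (v : E) (c : ℝ) (hc : 0 < c) :
    randersNorm B ℓ (c • v) = c * randersNorm B ℓ v := by
  have scale : √(B (c • v) (c • v)) = c * √(B v v) := by
    simp only [map_smul, smul_apply, smul_eq_mul, ← mul_assoc]
    rw [Real.sqrt_mul (mul_self_nonneg c), Real.sqrt_mul_self hc.le]
  rw [randersNorm, scale, map_smul, smul_eq_mul, randersNorm, mul_add]

theorem contDiffAt_randersNorm (ℓ : E →L[ℝ] ℝ) (hv : B v v ≠ 0) {n : ℕ∞ω} :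
    ContDiffAt ℝ n (randersNorm B ℓ) v :=
  ((B.contDiff.clm_apply contDiff_id).contDiffAt.sqrt hv).add ℓ.contDiff.contDiffAt

theorem hasFDerivAt_sqrt_bilinForm (hB : ∀ u w, B u w = B w u) (hv : B v v ≠ 0) :
    HasFDerivAt (fun u => √(B u u)) ((√(B v v))⁻¹ • B v) v := by
  refine ((B.hasFDerivAt_of_bilinear (hasFDerivAt_id v) (hasFDerivAt_id v)).sqrt hv).congr_fderiv ?_
  ext w
  simp only [id_eq, one_div, mul_inv_rev, ContinuousLinearMap.precompR_apply,
    ContinuousLinearMap.compL_apply, ContinuousLinearMap.comp_id, smul_add, add_apply, smul_apply,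
    smul_eq_mul, ContinuousLinearMap.precompL_apply, ContinuousLinearMap.id_apply, hB w v]
  ring

theorem fderiv_fderiv_randersNorm (hB : ∀ u w, B u w = B w u) (ℓ : E →L[ℝ] ℝ) (hv : 0 < B v v)
    (w : E) :
    fderiv ℝ (fderiv ℝ (randersNorm B ℓ)) v w w =
      (B v v * B w w - B v w ^ 2) / √(B v v) ^ 3 := by
  have first : fderiv ℝ (randersNorm B ℓ) =ᶠ[𝓝 v] fun u => (√(B u u))⁻¹ • B u + ℓ := by
    have nhd : ∀ᶠ u in 𝓝 v, 0 < B u u :=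
      (B.continuous.clm_apply continuous_id).continuousAt.eventually_const_lt hv
    filter_upwards [nhd] with u hu
      using ((hasFDerivAt_sqrt_bilinForm hB hu.ne').add ℓ.hasFDerivAt).fderiv
  have sqrt_ne : √(B v v) ≠ 0 := (Real.sqrt_pos.2 hv).ne'
  have inv_sqrt : HasFDerivAt (fun u => (√(B u u))⁻¹) _ v :=
    (hasFDerivAt_inv sqrt_ne).comp v (hasFDerivAt_sqrt_bilinForm hB hv.ne')
  rw [first.fderiv_eq, ((inv_sqrt.fun_smul B.hasFDerivAt).add_const ℓ).fderiv]
  simp only [ContinuousLinearMap.comp_smulₛₗ, map_inv₀, Real.ringHom_apply, add_apply, smul_apply,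
    ContinuousLinearMap.smulRight_apply, ContinuousLinearMap.comp_apply,
    ContinuousLinearMap.toSpanSingleton_apply, smul_eq_mul, mul_neg, neg_smul, neg_apply]
  field_simp
  rw [Real.sq_sqrt hv.le]
  ring

theorem fderiv_fderiv_randersNorm_pos (hB : ∀ u w, B u w = B w u) (hpos : ∀ u ≠ 0, 0 < B u u)
    (ℓ : E →L[ℝ] ℝ) {w : E} (hvw : LinearIndependent ℝ ![v, w]) :
    0 < fderiv ℝ (fderiv ℝ (randersNorm B ℓ)) v w w := by
  have hv : 0 < B v v := hpos v (by simpa using hvw.ne_zero 0)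
  rw [fderiv_fderiv_randersNorm hB ℓ hv]
  have cauchy_schwarz : B v w ^ 2 < B v v * B w w :=
    (LinearMap.BilinForm.apply_sq_lt_iff_linearIndependent_of_symm B.toLinearMap₁₂ hpos
      ⟨fun u w => hB u w⟩ v w).2 hvw
  exact div_pos (sub_pos.2 cauchy_schwarz) (pow_pos (Real.sqrt_pos.2 hv) 3)

end RandersNorm

section Randers

section MatrixForm

variable {n : Type*} [Fintype n] [DecidableEq n] {A : Matrix n n ℝ}

/-- The bilinear form `v ⬝ᵥ A *ᵥ w` of a matrix, as a continuous bilinear map. -/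
def matrixForm (A : Matrix n n ℝ) : (n → ℝ) →L[ℝ] (n → ℝ) →L[ℝ] ℝ :=
  (Matrix.toBilin' A).toContinuousBilinearMap

theorem matrixForm_apply (A : Matrix n n ℝ) (v w : n → ℝ) :
    matrixForm A v w = v ⬝ᵥ (A *ᵥ w) := by
  rw [matrixForm, LinearMap.toContinuousBilinearMap_apply, Matrix.toBilin'_apply']

theorem isSymm_toBilin'_of_posDef (hA : A.PosDef) : (Matrix.toBilin' A).IsSymm :=
  Matrix.isSymm_toBilin'_iff_isSymm.2 (Matrix.isHermitian_iff_isSymm.1 hA.isHermitian)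

theorem matrixForm_comm (hA : A.PosDef) (v w : n → ℝ) : matrixForm A v w = matrixForm A w v :=
  (isSymm_toBilin'_of_posDef hA).eq v w

theorem matrixForm_pos (hA : A.PosDef) {v : n → ℝ} (hv : v ≠ 0) : 0 < matrixForm A v v := by
  rw [matrixForm_apply]
  exact hA.dotProduct_mulVec_pos hv

theorem dotProduct_sq_le_of_posDef (hA : A.PosDef) (ρ v : n → ℝ) :
    (ρ ⬝ᵥ v) ^ 2 ≤ (ρ ⬝ᵥ (A⁻¹ *ᵥ ρ)) * (v ⬝ᵥ (A *ᵥ v)) := by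
  have cauchy_schwarz := (Matrix.toBilin' A).apply_sq_le_of_symm
    (fun x => by simpa [Matrix.toBilin'_apply'] using hA.posSemidef.dotProduct_mulVec_nonneg x)
    ⟨(isSymm_toBilin'_of_posDef hA).eq⟩ v (A⁻¹ *ᵥ ρ)
  have mul_inv : A *ᵥ (A⁻¹ *ᵥ ρ) = ρ := by
    rw [Matrix.mulVec_mulVec, A.mul_nonsing_inv (A.isUnit_iff_isUnit_det.1 hA.isUnit),
      Matrix.one_mulVec]
  rwa [Matrix.toBilin'_apply', Matrix.toBilin'_apply', Matrix.toBilin'_apply', mul_inv,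
    dotProduct_comm v, dotProduct_comm _ ρ, mul_comm] at cauchy_schwarz

theorem abs_dotProduct_lt_sqrt_of_posDef (hA : A.PosDef) {ρ v : n → ℝ}
    (hρ : √(ρ ⬝ᵥ (A⁻¹ *ᵥ ρ)) < 1) (hv : v ≠ 0) : |ρ ⬝ᵥ v| < √(v ⬝ᵥ (A *ᵥ v)) :=
  have norm_pos : 0 < √(v ⬝ᵥ (A *ᵥ v)) := Real.sqrt_pos.2 (hA.dotProduct_mulVec_pos hv)
  calc
    |ρ ⬝ᵥ v| ≤ √((ρ ⬝ᵥ (A⁻¹ *ᵥ ρ)) * (v ⬝ᵥ (A *ᵥ v))) :=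
      Real.abs_le_sqrt (dotProduct_sq_le_of_posDef hA ρ v)
    _ = √(ρ ⬝ᵥ (A⁻¹ *ᵥ ρ)) * √(v ⬝ᵥ (A *ᵥ v)) :=
      Real.sqrt_mul' _ (hA.dotProduct_mulVec_pos hv).le
    _ < √(v ⬝ᵥ (A *ᵥ v)) := mul_lt_of_lt_one_left norm_pos hρ

end MatrixForm

/-- The linear form `v ↦ ρ ⬝ᵥ v`, as a continuous linear map. -/
def covector (ρ : Plane) : Plane →L[ℝ] ℝ := (dotProductBilin ℝ ℝ ρ).toContinuousLinearMap

theorem randers_eq_randersNorm (g : T2 → Matrix (Fin 2) (Fin 2) ℝ) (ρ : T2 → Plane) (x : T2) :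
    randers g ρ x = randersNorm (matrixForm (g x)) (covector (ρ x)) := by
  ext v
  rw [randersNorm, matrixForm_apply]
  rfl

variable {g : T2 → Matrix (Fin 2) (Fin 2) ℝ} {ρ : T2 → Plane}

theorem continuous_randers (hg : Continuous g) (hρ : Continuous ρ) :
    Continuous fun q : T2 × Plane => randers g ρ q.1 q.2 := by
  unfold randers
  fun_prop

theorem contDiffOn_randers (hg : ∀ i j, ContDiff ℝ ∞ fun p : Plane => g (proj p) i j)
    (hρ : ∀ i, ContDiff ℝ ∞ fun p : Plane => ρ (proj p) i) (hpos : ∀ x, (g x).PosDef) :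
    ContDiffOn ℝ ∞ (fun q : Plane × Plane => randers g ρ (proj q.1) q.2) {q | q.2 ≠ 0} := by
  have hg' (i j : Fin 2) : ContDiff ℝ ∞ fun q : Plane × Plane => g (proj q.1) i j :=
    (hg i j).comp contDiff_fst
  have hρ' (i : Fin 2) : ContDiff ℝ ∞ fun q : Plane × Plane => ρ (proj q.1) i :=
    (hρ i).comp contDiff_fst
  have hv (i : Fin 2) : ContDiff ℝ ∞ fun q : Plane × Plane => q.2 i := by fun_prop
  have row_smooth (i : Fin 2) :
      ContDiff ℝ ∞ fun q : Plane × Plane => (g (proj q.1) *ᵥ q.2) i := by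
    simp only [Matrix.mulVec, dotProduct]
    exact .sum fun j _ => (hg' i j).mul (hv j)
  have metric_smooth : ContDiff ℝ ∞ fun q : Plane × Plane => q.2 ⬝ᵥ (g (proj q.1) *ᵥ q.2) :=
    .sum fun i _ => (hv i).mul (row_smooth i)
  have form_smooth : ContDiff ℝ ∞ fun q : Plane × Plane => ρ (proj q.1) ⬝ᵥ q.2 :=
    .sum fun i _ => (hρ' i).mul (hv i)
  exact (metric_smooth.contDiffOn.sqrt fun q hq =>
    ((hpos (proj q.1)).dotProduct_mulVec_pos hq).ne').add form_smooth.contDiffOn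

theorem randers_pos {x : T2} (hpos : (g x).PosDef) (hρ : √(ρ x ⬝ᵥ ((g x)⁻¹ *ᵥ ρ x)) < 1)
    {v : Plane} (hv : v ≠ 0) : 0 < randers g ρ x v := by
  have bound := (abs_lt.1 (abs_dotProduct_lt_sqrt_of_posDef hpos hρ hv)).1
  rw [randers]
  linarith

theorem isFinslerMetric_of_isRandersMetric {F : T2 → Plane → ℝ} (hF : IsRandersMetric F) :
    IsFinslerMetric F := by
  obtain ⟨g, ρ, smooth_g, smooth_ρ, hpos, hρ, rfl⟩ := hF
  have zero_apply (x : T2) : randers g ρ x 0 = 0 := by simp [randers]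
  have homogeneous (x : T2) (v : Plane) (c : ℝ) (hc : 0 < c) :
      randers g ρ x (c • v) = c * randers g ρ x v := by
    rw [randers_eq_randersNorm, randersNorm_smul _ _ _ _ hc]
  exact
    { continuous := continuous_randers
        (continuous_of_continuous_comp_proj
          (continuous_matrix fun i j => (smooth_g i j).continuous))
        (continuous_of_continuous_comp_proj (continuous_pi fun i => (smooth_ρ i).continuous))
      smooth := contDiffOn_randers smooth_g smooth_ρ hpos
      homogeneous := homogeneous
      nonneg := fun x v => by
        rcases eq_or_ne v 0 with rfl | hv
        · exact (zero_apply x).ge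
        · exact (randers_pos (hpos x) (hρ x) hv).le
      eq_zero_iff := fun x v =>
        ⟨not_imp_not.1 fun hv => (randers_pos (hpos x) (hρ x) hv).ne', fun hv => hv ▸ zero_apply x⟩
      strongly_convex := fun x v w hv hw => by
        refine fderiv_fderiv_sq_pos_of_posHomogeneous (homogeneous x) ?_ hv
          (randers_pos (hpos x) (hρ x) hv) (fun u hvu => ?_) hw
        · rw [randers_eq_randersNorm]
          exact contDiffAt_randersNorm _ (matrixForm_pos (hpos x) hv).ne'
        · rw [randers_eq_randersNorm]
          exact fderiv_fderiv_randersNorm_pos (matrixForm_comm (hpos x))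
            (fun _ => matrixForm_pos (hpos x)) _ hvu }

end Randers

/-! ### Translation-invariant metrics -/

theorem extDeriv_ofSubsingleton_apply {E : Type*} [NormedAddCommGroup E] [NormedSpace ℝ E]
    {α : E → E →L[ℝ] ℝ} {x : E} (hα : DifferentiableAt ℝ α x) (u v : E) :
    extDeriv (fun y => ContinuousAlternatingMap.ofSubsingleton ℝ E ℝ (0 : Fin 1) (α y)) x ![u, v] =
      fderiv ℝ α x u v - fderiv ℝ α x v u := by
  have coefficient (w : Fin 1 → E) :
      fderiv ℝ (fun y => ContinuousAlternatingMap.ofSubsingleton ℝ E ℝ (0 : Fin 1) (α y) w) x =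
        (fderiv ℝ α x).flip (w 0) :=
    (hα.hasFDerivAt.clm_apply (hasFDerivAt_const (w 0) x)).fderiv.trans (by simp)
  have diff : DifferentiableAt ℝ
      (fun y => ContinuousAlternatingMap.ofSubsingleton ℝ E ℝ (0 : Fin 1) (α y)) x :=
    (ContinuousAlternatingMap.ofSubsingletonLIE (𝕜 := ℝ) (E := E) (F := ℝ)
      (0 : Fin 1)).differentiable.differentiableAt.comp x hα
  rw [extDeriv_apply diff, Fin.sum_univ_two, coefficient, coefficient]
  simp [Fin.removeNth, sub_eq_add_neg]

theorem fderiv_apply_inl {E F : Type*} [NormedAddCommGroup E] [NormedSpace ℝ E]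
    [NormedAddCommGroup F] [NormedSpace ℝ F] {G : E × F → ℝ} {q : E × F}
    (hG : DifferentiableAt ℝ G q) (v : E) :
    fderiv ℝ G q (v, 0) = fderiv ℝ (fun p => G (p, q.2)) q.1 v := by
  have slice : HasFDerivAt (fun p => G (p, q.2)) ((fderiv ℝ G q).comp (.inl ℝ E F)) q.1 :=
    HasFDerivAt.comp (g := G) q.1 hG.hasFDerivAt (hasFDerivAt_prodMk_left q.1 q.2)
  rw [slice.fderiv]
  rfl

section Directions

/-- The unit vector `(-sin θ, cos θ)` a quarter turn ahead of `dir θ`. -/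
def normal (θ : ℝ) : Plane := ![-Real.sin θ, Real.cos θ]

theorem hasDerivAt_dir (θ : ℝ) : HasDerivAt dir (normal θ) θ :=
  hasDerivAt_pi.2 <| Fin.forall_fin_two.2 ⟨Real.hasDerivAt_cos θ, Real.hasDerivAt_sin θ⟩

theorem dir_dotProduct_dir (θ : ℝ) : dir θ ⬝ᵥ dir θ = 1 := by
  simp only [dir, Matrix.vec2_dotProduct']
  linear_combination Real.cos_sq_add_sin_sq θ

theorem normal_dotProduct_normal (θ : ℝ) : normal θ ⬝ᵥ normal θ = 1 := by
  simp only [normal, Matrix.vec2_dotProduct']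
  linear_combination Real.cos_sq_add_sin_sq θ

theorem normal_dotProduct_dir (θ : ℝ) : normal θ ⬝ᵥ dir θ = 0 := by
  simp only [dir, normal, Matrix.vec2_dotProduct']
  ring

theorem dir_ne_zero (θ : ℝ) : dir θ ≠ 0 := fun h => by
  simpa [h] using dir_dotProduct_dir θ

theorem dir_smul_add_normal_smul (θ : ℝ) (v : Plane) :
    (dir θ ⬝ᵥ v) • dir θ + (normal θ ⬝ᵥ v) • normal θ = v := by
  have pythagoras := Real.cos_sq_add_sin_sq θ
  ext i
  fin_cases i <;> simp only [dir, normal, Matrix.vec2_dotProduct, Pi.add_apply, Pi.smul_apply,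
    smul_eq_mul, Fin.zero_eta, Fin.mk_one, Fin.isValue, Matrix.cons_val_zero, Matrix.cons_val_one]
  · linear_combination v 0 * pythagoras
  · linear_combination v 1 * pythagoras

end Directions

namespace IsFinslerMetric

variable {F : T2 → Plane → ℝ}

theorem pos (hF : IsFinslerMetric F) (x : T2) {v : Plane} (hv : v ≠ 0) : 0 < F x v :=
  (hF.nonneg x v).lt_of_ne' fun h => hv ((hF.eq_zero_iff x v).1 h)

theorem contDiffAt (hF : IsFinslerMetric F) (p : Plane) {v : Plane} (hv : v ≠ 0) :
    ContDiffAt ℝ 2 (F (proj p)) v := by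
  have smooth : ContDiffAt ℝ ∞ (fun q : Plane × Plane => F (proj q.1) q.2) (p, v) :=
    hF.smooth.contDiffAt ((isOpen_ne_fun continuous_snd continuous_const).mem_nhds hv)
  have smooth_two := smooth.of_le (m := 2) (WithTop.coe_le_coe.2 le_top)
  exact smooth_two.comp v (contDiff_prodMk_right p).contDiffAt

end IsFinslerMetric

section TranslationInvariant

variable {φ : Plane → ℝ}

/-- The Hessian of `φ` at the direction `dir θ`, evaluated on the orthogonal vector `normal θ`. For
a positively homogeneous `φ` it determines the whole Hessian at `dir θ`. -/
def angularHessian (φ : Plane → ℝ) (θ : ℝ) : ℝ :=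
  fderiv ℝ (fderiv ℝ φ) (dir θ) (normal θ) (normal θ)

theorem fderiv_apply_dir (hF : IsFinslerMetric fun _ => φ) (θ : ℝ) :
    fderiv ℝ φ (dir θ) (dir θ) = φ (dir θ) :=
  fderiv_apply_self_of_posHomogeneous (hF.homogeneous 0)
    ((hF.contDiffAt 0 (dir_ne_zero θ)).differentiableAt two_ne_zero)

theorem fderiv_fderiv_apply_dir (hF : IsFinslerMetric fun _ => φ) (θ : ℝ) (w : Plane) :
    fderiv ℝ (fderiv ℝ φ) (dir θ) w (dir θ) = 0 :=
  fderiv_fderiv_apply_self_of_posHomogeneous (hF.homogeneous 0)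
    (hF.contDiffAt 0 (dir_ne_zero θ)) w

theorem fderiv_fderiv_normal_apply (hF : IsFinslerMetric fun _ => φ) (θ : ℝ) (w : Plane) :
    fderiv ℝ (fderiv ℝ φ) (dir θ) (normal θ) w = angularHessian φ θ * (normal θ ⬝ᵥ w) := by
  conv_lhs => rw [← dir_smul_add_normal_smul θ w]
  rw [map_add, map_smul, map_smul, fderiv_fderiv_apply_dir hF, smul_zero, zero_add, smul_eq_mul,
    mul_comm, angularHessian]

/-- The Hessian of `φ ^ 2` is tested on the vector `φ v • w - (Dφ v w) • v`, `v = dir θ` and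
`w = normal θ`, which `Dφ v` annihilates. -/
theorem angularHessian_pos (hF : IsFinslerMetric fun _ => φ) (θ : ℝ) : 0 < angularHessian φ θ := by
  have smooth := hF.contDiffAt 0 (dir_ne_zero θ)
  have symm : IsSymmSndFDerivAt ℝ φ (dir θ) :=
    smooth.isSymmSndFDerivAt (minSmoothness_of_isRCLikeNormedField).le
  have φ_pos : 0 < φ (dir θ) := hF.pos 0 (dir_ne_zero θ)
  set w := φ (dir θ) • normal θ - fderiv ℝ φ (dir θ) (normal θ) • dir θ
  have tangent : fderiv ℝ φ (dir θ) w = 0 := by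
    rw [map_sub, map_smul, map_smul, fderiv_apply_dir hF, smul_eq_mul, smul_eq_mul, mul_comm,
      sub_self]
  have hessian : fderiv ℝ (fderiv ℝ φ) (dir θ) w w = φ (dir θ) ^ 2 * angularHessian φ θ := by
    have vanish (u : Plane) : fderiv ℝ (fderiv ℝ φ) (dir θ) (dir θ) u = 0 := by
      rw [symm.eq, fderiv_fderiv_apply_dir hF]
    simp only [w, map_sub, map_smul, sub_apply, smul_apply, vanish, fderiv_fderiv_apply_dir hF,
      smul_eq_mul, angularHessian]
    ring
  have w_ne : w ≠ 0 := fun hw => by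
    have := congrArg (normal θ ⬝ᵥ ·) hw
    simp only [w, dotProduct_sub, dotProduct_smul, normal_dotProduct_normal, normal_dotProduct_dir,
      dotProduct_zero, smul_eq_mul, mul_one, mul_zero, sub_zero] at this
    exact φ_pos.ne' this
  have convex := hF.strongly_convex 0 (dir θ) w (dir_ne_zero θ) w_ne
  rw [fderiv_fderiv_sq smooth, tangent, hessian] at convex
  have : 0 < 2 * φ (dir θ) ^ 3 * angularHessian φ θ := by linarith
  exact pos_of_mul_pos_right this (by positivity)

theorem hasDerivAt_fderiv_dir (hF : IsFinslerMetric fun _ => φ) (θ : ℝ) :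
    HasDerivAt (fun θ => fderiv ℝ φ (dir θ)) (angularHessian φ θ • covector (normal θ)) θ := by
  refine ((differentiableAt_fderiv_of_contDiffAt (hF.contDiffAt 0 (dir_ne_zero θ))
    ).hasFDerivAt.comp_hasDerivAt θ (hasDerivAt_dir θ)).congr_deriv ?_
  ext1 w
  exact fderiv_fderiv_normal_apply hF θ w

theorem hilbertForm_apply (F : T2 → Plane → ℝ) (q u : HPlane) :
    hilbertForm F q u = fderiv ℝ (F (proj q.1)) (dir q.2) u.1 := rfl

theorem hasFDerivAt_hilbertForm (hF : IsFinslerMetric fun _ => φ) (q : HPlane) :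
    HasFDerivAt (hilbertForm fun _ => φ)
      ((ContinuousLinearMap.snd ℝ Plane ℝ).smulRight
        ((angularHessian φ q.2 • covector (normal q.2)).comp (.fst ℝ Plane ℝ))) q := by
  have along_fibre := (hasDerivAt_fderiv_dir hF q.2).hasFDerivAt.comp q hasFDerivAt_snd
  exact along_fibre.clm_comp (hasFDerivAt_const _ q) |>.congr_fderiv <| by
    ext <;> simp

theorem dHilbertForm_translationInvariant (hF : IsFinslerMetric fun _ => φ) (q u v : HPlane) :
    dHilbertForm (fun _ => φ) q ![u, v] =
      angularHessian φ q.2 * (u.2 * (normal q.2 ⬝ᵥ v.1) - v.2 * (normal q.2 ⬝ᵥ u.1)) := by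
  have deriv := hasFDerivAt_hilbertForm hF q
  rw [dHilbertForm, extDeriv_ofSubsingleton_apply deriv.differentiableAt, deriv.fderiv]
  change u.2 * (angularHessian φ q.2 * (normal q.2 ⬝ᵥ v.1)) -
    v.2 * (angularHessian φ q.2 * (normal q.2 ⬝ᵥ u.1)) = _
  ring

theorem contactVolume_translationInvariant (hF : IsFinslerMetric fun _ => φ) (p : Plane) (θ : ℝ) :
    contactVolume (fun _ => φ) (p, θ) eθ ex ey = -(φ (dir θ) * angularHessian φ θ) := by
  have euler : fderiv ℝ φ (dir θ) ex.1 * Real.cos θ + fderiv ℝ φ (dir θ) ey.1 * Real.sin θ =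
      φ (dir θ) := by
    have dir_eq : dir θ = Real.cos θ • ex.1 + Real.sin θ • ey.1 := by
      ext i
      fin_cases i <;> simp [dir, ex, ey]
    rw [← fderiv_apply_dir hF θ]
    conv_rhs => rw [dir_eq, map_add, map_smul, map_smul, ← dir_eq]
    simp only [smul_eq_mul, mul_comm]
  rw [← euler]
  simp only [contactVolume, dHilbertForm_translationInvariant hF, hilbertForm_apply, eθ, map_zero,
    zero_mul, zero_add, dotProduct_zero, mul_zero, sub_zero, zero_sub, one_mul]
  simp only [ex, ey, normal, Matrix.vec2_dotProduct', mul_zero, mul_one, zero_add, add_zero]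
  ring

theorem hilbertForm_inv_smul_dir (hF : IsFinslerMetric fun _ => φ) (q : HPlane) :
    hilbertForm (fun _ => φ) q ((φ (dir q.2))⁻¹ • dir q.2, 0) = 1 := by
  rw [hilbertForm_apply, map_smul, fderiv_apply_dir hF, smul_eq_mul,
    inv_mul_cancel₀ (hF.pos 0 (dir_ne_zero q.2)).ne']

theorem dHilbertForm_smul_dir (hF : IsFinslerMetric fun _ => φ) (q : HPlane) (c : ℝ) (w : HPlane) :
    dHilbertForm (fun _ => φ) q ![(c • dir q.2, 0), w] = 0 := by
  rw [dHilbertForm_translationInvariant hF]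
  simp only [dotProduct_smul, normal_dotProduct_dir, smul_zero, mul_zero, zero_mul, sub_zero]

theorem eq_inv_smul_dir_of_hilbertForm_eq_one (hF : IsFinslerMetric fun _ => φ) {q X : HPlane}
    (normalized : hilbertForm (fun _ => φ) q X = 1)
    (kernel : ∀ w, dHilbertForm (fun _ => φ) q ![X, w] = 0) :
    X = ((φ (dir q.2))⁻¹ • dir q.2, 0) := by
  have K_ne := (angularHessian_pos hF q.2).ne'
  have angle_zero : X.2 = 0 := by
    simpa only [dHilbertForm_translationInvariant hF, normal_dotProduct_normal, zero_mul, sub_zero,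
      mul_one, mul_eq_zero, K_ne, false_or] using kernel (normal q.2, 0)
  have normal_zero : normal q.2 ⬝ᵥ X.1 = 0 := by
    simpa only [dHilbertForm_translationInvariant hF, dotProduct_zero, mul_zero, one_mul, zero_sub,
      mul_eq_zero, neg_eq_zero, K_ne, false_or] using kernel (0, 1)
  have radial : (dir q.2 ⬝ᵥ X.1) • dir q.2 = X.1 := by
    simpa only [normal_zero, zero_smul, add_zero] using dir_smul_add_normal_smul q.2 X.1
  have length : (dir q.2 ⬝ᵥ X.1) * φ (dir q.2) = 1 := by
    rwa [hilbertForm_apply, ← radial, map_smul, fderiv_apply_dir hF] at normalized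
  exact Prod.ext (by rw [← radial, eq_inv_of_mul_eq_one_left length]) angle_zero

theorem reeb_translationInvariant (hF : IsFinslerMetric fun _ => φ) (q : HPlane) :
    reeb (fun _ => φ) q = ((φ (dir q.2))⁻¹ • dir q.2, 0) := by
  obtain ⟨normalized, kernel⟩ := Classical.epsilon_spec
    (p := fun X => hilbertForm (fun _ => φ) q X = 1 ∧ ∀ w, dHilbertForm (fun _ => φ) q ![X, w] = 0)
    ⟨_, hilbertForm_inv_smul_dir hF q, dHilbertForm_smul_dir hF q _⟩
  exact eq_inv_smul_dir_of_hilbertForm_eq_one hF normalized kernel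

theorem volumeForm_translationInvariant (hF : IsFinslerMetric fun _ => φ) (p : Plane) :
    volumeForm (fun _ => φ) p =
      -((2 * π)⁻¹ * ∫ θ in (0 : ℝ)..(2 * π), φ (dir θ) * angularHessian φ θ) := by
  simp only [volumeForm, contactVolume_translationInvariant hF, intervalIntegral.integral_neg,
    mul_neg]

theorem lieReeb_translationInvariant (hF : IsFinslerMetric fun _ => φ) (G : HPlane → ℝ)
    (q : HPlane) :
    lieReeb (fun _ => φ) G q = (φ (dir q.2))⁻¹ * fderiv ℝ G q (dir q.2, 0) := by
  have : reeb (fun _ => φ) q = (φ (dir q.2))⁻¹ • (dir q.2, 0) := by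
    rw [reeb_translationInvariant hF, Prod.smul_mk, smul_zero]
  rw [lieReeb, this, map_smul, smul_eq_mul]

theorem lieReeb_lieReeb_translationInvariant (hF : IsFinslerMetric fun _ => φ) {f : T2 → ℝ}
    (hf : ContDiff ℝ 2 fun p => f (proj p)) (p : Plane) (θ : ℝ) :
    lieReeb (fun _ => φ) (lieReeb (fun _ => φ) fun q => f (proj q.1)) (p, θ) =
      fderiv ℝ (fderiv ℝ fun p => f (proj p)) p (dir θ) (dir θ) / φ (dir θ) ^ 2 := by
  set u : Plane → ℝ := fun p => f (proj p)
  have diff_u : Differentiable ℝ u := hf.differentiable two_ne_zero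
  have diff_fderiv_u : DifferentiableAt ℝ (fderiv ℝ u) p :=
    differentiableAt_fderiv_of_contDiffAt hf.contDiffAt
  have first : (lieReeb (fun _ => φ) fun q => f (proj q.1)) =
      fun q => (φ (dir q.2))⁻¹ * fderiv ℝ u q.1 (dir q.2) := by
    funext q
    rw [lieReeb_translationInvariant hF, fderiv_apply_inl (G := fun q => f (proj q.1))
      ((diff_u q.1).comp q differentiableAt_fst)]
  have diff_dir : Differentiable ℝ fun q : HPlane => dir q.2 := fun q =>
    (hasDerivAt_dir q.2).differentiableAt.comp q differentiableAt_snd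
  have diff_φ : DifferentiableAt ℝ (fun q : HPlane => (φ (dir q.2))⁻¹) (p, θ) :=
    (((hF.contDiffAt 0 (dir_ne_zero θ)).differentiableAt two_ne_zero).comp (p, θ) (diff_dir _)).inv
      (hF.pos 0 (dir_ne_zero θ)).ne'
  have diff_first : DifferentiableAt ℝ
      (fun q : HPlane => (φ (dir q.2))⁻¹ * fderiv ℝ u q.1 (dir q.2)) (p, θ) :=
    diff_φ.mul ((diff_fderiv_u.comp (p, θ) differentiableAt_fst).clm_apply (diff_dir _))
  have second := ((diff_fderiv_u.hasFDerivAt.clm_apply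
    (hasFDerivAt_const (dir θ) p)).const_mul (φ (dir θ))⁻¹).fderiv
  rw [first, lieReeb_translationInvariant hF, fderiv_apply_inl diff_first, second]
  simp only [ContinuousLinearMap.comp_zero, zero_add, smul_apply, ContinuousLinearMap.flip_apply,
    smul_eq_mul]
  ring

theorem laplacian_translationInvariant (hF : IsFinslerMetric fun _ => φ) {f : T2 → ℝ}
    (hf : ContDiff ℝ 2 fun p => f (proj p)) (p : Plane) :
    laplacian (fun _ => φ) f p = -(π * volumeForm (fun _ => φ) p)⁻¹ *
      ∫ θ in (0 : ℝ)..(2 * π), fderiv ℝ (fderiv ℝ fun p => f (proj p)) p (dir θ) (dir θ) *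
        (angularHessian φ θ / φ (dir θ)) := by
  have integrand (θ : ℝ) :
      lieReeb (fun _ => φ) (lieReeb (fun _ => φ) fun q => f (proj q.1)) (p, θ) *
        angleForm (fun _ => φ) (p, θ) =
      -(volumeForm (fun _ => φ) p)⁻¹ *
        (fderiv ℝ (fderiv ℝ fun p => f (proj p)) p (dir θ) (dir θ) *
          (angularHessian φ θ / φ (dir θ))) := by
    have φ_ne : φ (dir θ) ≠ 0 := (hF.pos 0 (dir_ne_zero θ)).ne'
    rw [lieReeb_lieReeb_translationInvariant hF hf, angleForm,
      contactVolume_translationInvariant hF]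
    field_simp
  simp only [laplacian, integrand, intervalIntegral.integral_const_mul]
  field_simp

end TranslationInvariant

/-! ### Integrals over the polar angle of an ellipse -/

section Ellipse

variable {a b : ℝ}

/-- The standard parametrization `θ ↦ (a cos θ, b sin θ)` of an ellipse. -/
def ellipse (a b θ : ℝ) : ℂ := ⟨a * Real.cos θ, b * Real.sin θ⟩

/-- The polar angle along the ellipse, as a continuous function of the parameter: for `a, b > 0`
the point `ellipse a b θ` makes an acute angle with `exp (θ * I)`. -/
def ellipseAngle (a b θ : ℝ) : ℝ :=
  θ + (Complex.log (ellipse a b θ * Complex.exp (-(θ * Complex.I)))).im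

theorem re_ellipse_mul_exp_pos (ha : 0 < a) (hb : 0 < b) (θ : ℝ) :
    0 < (ellipse a b θ * Complex.exp (-(θ * Complex.I))).re := by
  have re_eq : (ellipse a b θ * Complex.exp (-(θ * Complex.I))).re =
      a * Real.cos θ ^ 2 + b * Real.sin θ ^ 2 := by
    rw [← neg_mul, ← Complex.ofReal_neg, Complex.mul_re, Complex.exp_ofReal_mul_I_re,
      Complex.exp_ofReal_mul_I_im, Real.cos_neg, Real.sin_neg, ellipse]
    ring
  rw [re_eq]
  rcases eq_or_ne (Real.cos θ) 0 with hc | hc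
  · have sin_sq : Real.sin θ ^ 2 = 1 := by simpa [hc] using Real.sin_sq_add_cos_sq θ
    simpa [hc, sin_sq] using hb
  · positivity

theorem ellipse_ne_zero (ha : 0 < a) (hb : 0 < b) (θ : ℝ) : ellipse a b θ ≠ 0 := fun h => by
  simpa [h] using re_ellipse_mul_exp_pos ha hb θ

theorem ellipse_mul_exp_mem_slitPlane (ha : 0 < a) (hb : 0 < b) (θ : ℝ) :
    ellipse a b θ * Complex.exp (-(θ * Complex.I)) ∈ Complex.slitPlane :=
  .inl (re_ellipse_mul_exp_pos ha hb θ)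

theorem norm_mul_exp_ellipseAngle (a b θ : ℝ) :
    ‖ellipse a b θ‖ * Complex.exp (ellipseAngle a b θ * Complex.I) = ellipse a b θ := by
  set z := ellipse a b θ * Complex.exp (-(θ * Complex.I))
  have norm_eq : ‖z‖ = ‖ellipse a b θ‖ := by
    rw [norm_mul, ← neg_mul, ← Complex.ofReal_neg, Complex.norm_exp_ofReal_mul_I, mul_one]
  rw [ellipseAngle, Complex.log_im, Complex.ofReal_add, add_mul, Complex.exp_add, ← norm_eq,
    mul_left_comm, Complex.norm_mul_exp_arg_mul_I, mul_comm, mul_assoc, ← Complex.exp_add,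
    neg_add_cancel, Complex.exp_zero, mul_one]

theorem norm_mul_cos_ellipseAngle (a b θ : ℝ) :
    ‖ellipse a b θ‖ * Real.cos (ellipseAngle a b θ) = a * Real.cos θ := by
  rw [← Complex.exp_ofReal_mul_I_re, ← Complex.re_ofReal_mul, norm_mul_exp_ellipseAngle, ellipse]

theorem norm_mul_sin_ellipseAngle (a b θ : ℝ) :
    ‖ellipse a b θ‖ * Real.sin (ellipseAngle a b θ) = b * Real.sin θ := by
  rw [← Complex.exp_ofReal_mul_I_im, ← Complex.im_ofReal_mul, norm_mul_exp_ellipseAngle, ellipse]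

theorem hasDerivAt_ellipse (a b θ : ℝ) :
    HasDerivAt (ellipse a b) ⟨-(a * Real.sin θ), b * Real.cos θ⟩ θ := by
  have re_im : ellipse a b =
      fun θ => ((a * Real.cos θ : ℝ) : ℂ) + (b * Real.sin θ : ℝ) * Complex.I :=
    funext fun θ => Complex.mk_eq_add_mul_I _ _
  rw [re_im, Complex.mk_eq_add_mul_I, ← mul_neg]
  exact ((Real.hasDerivAt_cos θ).const_mul a).ofReal_comp.add
    (((Real.hasDerivAt_sin θ).const_mul b).ofReal_comp.mul_const Complex.I)

theorem continuous_ellipse (a b : ℝ) : Continuous (ellipse a b) :=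
  continuous_iff_continuousAt.2 fun θ => (hasDerivAt_ellipse a b θ).continuousAt

theorem hasDerivAt_ellipseAngle (ha : 0 < a) (hb : 0 < b) (θ : ℝ) :
    HasDerivAt (ellipseAngle a b) (a * b / ‖ellipse a b θ‖ ^ 2) θ := by
  have rotation : HasDerivAt (fun θ : ℝ => Complex.exp (-(θ * Complex.I)))
      (Complex.exp (-(θ * Complex.I)) * -(1 * Complex.I)) θ :=
    (((hasDerivAt_id' θ).ofReal_comp.mul_const Complex.I).neg).cexp
  have log_deriv := ((hasDerivAt_ellipse a b θ).mul rotation).clog_real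
    (ellipse_mul_exp_mem_slitPlane ha hb θ)
  have im_deriv := (hasDerivAt_id' θ).add (Complex.imCLM.hasFDerivAt.comp_hasDerivAt θ log_deriv)
  refine im_deriv.congr_deriv ?_
  have quotient (z w e : ℂ) (hz : z ≠ 0) (he : e ≠ 0) :
      (w * e + z * (e * -(1 * Complex.I))) / (z * e) = w / z - Complex.I := by
    field_simp
    ring
  rw [Complex.imCLM_apply, Pi.mul_apply,
    quotient _ _ _ (ellipse_ne_zero ha hb θ) (Complex.exp_ne_zero _),
    Complex.sub_im, Complex.I_im, add_sub_cancel, Complex.div_im, Complex.normSq_eq_norm_sq,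
    ← sub_div]
  congr 1
  rw [ellipse]
  linear_combination a * b * Real.cos_sq_add_sin_sq θ

theorem ellipseAngle_zero (ha : 0 < a) (b : ℝ) : ellipseAngle a b 0 = 0 := by
  have : ellipse a b 0 = a := by simp [ellipse, Complex.ext_iff]
  simp [ellipseAngle, this, Complex.log_im, Complex.arg_ofReal_of_nonneg ha.le]

theorem ellipseAngle_two_pi (ha : 0 < a) (b : ℝ) : ellipseAngle a b (2 * π) = 2 * π := by
  have : ellipse a b (2 * π) = a := by simp [ellipse, Complex.ext_iff]
  have full_turn : Complex.exp (-((2 * π : ℝ) * Complex.I)) = 1 := by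
    simp [Complex.exp_neg]
  rw [ellipseAngle, full_turn, this, mul_one, Complex.log_im, Complex.arg_ofReal_of_nonneg ha.le,
    add_zero]

theorem integral_comp_ellipseAngle (ha : 0 < a) (hb : 0 < b) {G : ℝ → ℝ} (hG : Continuous G) :
    ∫ θ in (0 : ℝ)..(2 * π), G (ellipseAngle a b θ) * (a * b / ‖ellipse a b θ‖ ^ 2) =
      ∫ ψ in (0 : ℝ)..(2 * π), G ψ := by
  have continuous_deriv : Continuous fun θ => a * b / ‖ellipse a b θ‖ ^ 2 :=
    continuous_const.div ((continuous_ellipse a b).norm.pow 2)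
      fun θ => pow_ne_zero 2 (norm_ne_zero_iff.2 (ellipse_ne_zero ha hb θ))
  have change_of_variables := intervalIntegral.integral_comp_mul_deriv (a := 0) (b := 2 * π)
    (fun θ _ => hasDerivAt_ellipseAngle ha hb θ) continuous_deriv.continuousOn hG
  rwa [ellipseAngle_zero ha, ellipseAngle_two_pi ha] at change_of_variables

end Ellipse

section TrigIntegrals

variable {η : ℝ}

theorem one_sub_sq_pos (hη : |η| < 1) : 0 < 1 - η ^ 2 :=
  sub_pos.2 ((sq_lt_one_iff_abs_lt_one η).2 hη)

theorem one_add_mul_cos_pos (hη : |η| < 1) (ψ : ℝ) : 0 < 1 + η * Real.cos ψ := by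
  have bound : |η * Real.cos ψ| < 1 := by
    rw [abs_mul]
    exact (mul_le_of_le_one_right (abs_nonneg η) (Real.abs_cos_le_one ψ)).trans_lt hη
  linarith [(abs_lt.1 bound).1]

theorem continuous_div_one_add_mul_cos (hη : |η| < 1) {G : ℝ → ℝ} (hG : Continuous G) :
    Continuous fun ψ => G ψ / (1 + η * Real.cos ψ) :=
  hG.div (by fun_prop) fun ψ => (one_add_mul_cos_pos hη ψ).ne'

theorem norm_ellipse_sq (a b θ : ℝ) :
    ‖ellipse a b θ‖ ^ 2 = a ^ 2 * Real.cos θ ^ 2 + b ^ 2 * Real.sin θ ^ 2 := by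
  rw [← Complex.normSq_eq_norm_sq, ellipse, Complex.normSq_mk]
  ring

theorem integral_comp_two_mul {G : ℝ → ℝ} (hG : Continuous G) (periodic : G.Periodic (2 * π)) :
    ∫ θ in (0 : ℝ)..(2 * π), G (2 * θ) = ∫ ψ in (0 : ℝ)..(2 * π), G ψ := by
  have two_periods : ∫ ψ in (2 * π)..(2 * (2 * π)), G ψ = ∫ ψ in (0 : ℝ)..(2 * π), G ψ := by
    simpa only [zero_add, ← two_mul] using periodic.intervalIntegral_add_eq (2 * π) 0
  rw [intervalIntegral.integral_comp_mul_left _ two_ne_zero, mul_zero,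
    ← intervalIntegral.integral_add_adjacent_intervals (hG.intervalIntegrable 0 (2 * π))
      (hG.intervalIntegrable _ _), two_periods, smul_eq_mul]
  ring

/-- Halving the angle turns `1 + η cos ψ` into the squared norm of an ellipse with semi-axes
`√(1 + η)` and `√(1 - η)`. -/
theorem integral_inv_one_add_mul_cos (hη : |η| < 1) :
    ∫ ψ in (0 : ℝ)..(2 * π), 1 / (1 + η * Real.cos ψ) = 2 * π / √(1 - η ^ 2) := by
  obtain ⟨lower, upper⟩ := abs_lt.1 hη
  have hp : 0 < 1 + η := by linarith
  have hm : 0 < 1 - η := by linarith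
  have half_angle (θ : ℝ) : 1 + η * Real.cos (2 * θ) = ‖ellipse √(1 + η) √(1 - η) θ‖ ^ 2 := by
    rw [norm_ellipse_sq, Real.sq_sqrt hp.le, Real.sq_sqrt hm.le, Real.cos_two_mul, Real.sin_sq]
    ring
  have axes : √(1 + η) * √(1 - η) = √(1 - η ^ 2) := by
    rw [← Real.sqrt_mul hp.le]
    ring_nf
  have full_angle := integral_comp_ellipseAngle (Real.sqrt_pos.2 hp) (Real.sqrt_pos.2 hm)
    (continuous_const (y := (1 : ℝ)))
  simp only [axes, one_mul, ← half_angle, intervalIntegral.integral_const, sub_zero, smul_eq_mul,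
    mul_one, div_eq_mul_one_div √(1 - η ^ 2), intervalIntegral.integral_const_mul] at full_angle
  rw [integral_comp_two_mul (G := fun ψ => 1 / (1 + η * Real.cos ψ))
    (continuous_div_one_add_mul_cos hη continuous_const) fun ψ => by simp] at full_angle
  rw [eq_div_iff (Real.sqrt_pos.2 (one_sub_sq_pos hη)).ne', mul_comm, full_angle]

theorem integral_cos_sq_div_one_add_mul_cos (hη : |η| < 1) :
    ∫ ψ in (0 : ℝ)..(2 * π), Real.cos ψ ^ 2 / (1 + η * Real.cos ψ) =
      2 * π / (√(1 - η ^ 2) * (1 + √(1 - η ^ 2))) := by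
  rcases eq_or_ne η 0 with rfl | η_ne
  · norm_num [integral_cos_sq]
  have reduce (ψ : ℝ) : Real.cos ψ ^ 2 / (1 + η * Real.cos ψ) =
      (η * Real.cos ψ - 1 + 1 / (1 + η * Real.cos ψ)) / η ^ 2 := by
    have denom_ne := (one_add_mul_cos_pos hη ψ).ne'
    rw [eq_div_iff (pow_ne_zero 2 η_ne), div_mul_eq_mul_div, div_eq_iff denom_ne, add_mul,
      one_div_mul_cancel denom_ne]
    ring
  simp only [reduce, intervalIntegral.integral_div]
  rw [intervalIntegral.integral_add (Continuous.intervalIntegrable (by fun_prop) _ _)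
    ((continuous_div_one_add_mul_cos hη continuous_const).intervalIntegrable _ _),
    intervalIntegral.integral_sub (Continuous.intervalIntegrable (by fun_prop) _ _)
      (Continuous.intervalIntegrable (by fun_prop) _ _), intervalIntegral.integral_const_mul,
    integral_inv_one_add_mul_cos hη, integral_cos, intervalIntegral.integral_const, Real.sin_two_pi,
    Real.sin_zero, sub_zero, sub_zero, mul_zero, zero_sub, smul_eq_mul, mul_one]
  have s_pos : 0 < √(1 - η ^ 2) := Real.sqrt_pos.2 (one_sub_sq_pos hη)
  have s_sq : √(1 - η ^ 2) ^ 2 = 1 - η ^ 2 := Real.sq_sqrt (one_sub_sq_pos hη).le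
  field_simp
  linear_combination -s_sq

theorem integral_sin_sq_div_one_add_mul_cos (hη : |η| < 1) :
    ∫ ψ in (0 : ℝ)..(2 * π), Real.sin ψ ^ 2 / (1 + η * Real.cos ψ) =
      2 * π / (1 + √(1 - η ^ 2)) := by
  have s_pos : 0 < √(1 - η ^ 2) := Real.sqrt_pos.2 (one_sub_sq_pos hη)
  simp only [Real.sin_sq, sub_div]
  rw [intervalIntegral.integral_sub
    ((continuous_div_one_add_mul_cos hη continuous_const).intervalIntegrable _ _)
    ((continuous_div_one_add_mul_cos hη (by fun_prop)).intervalIntegrable _ _),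
    integral_inv_one_add_mul_cos hη, integral_cos_sq_div_one_add_mul_cos hη]
  field_simp
  ring

theorem integral_eq_zero_of_reflection_eq_neg {G : ℝ → ℝ} {T : ℝ} (odd : ∀ x, G (T - x) = -G x) :
    ∫ x in (0 : ℝ)..T, G x = 0 := by
  have reflect := intervalIntegral.integral_comp_sub_left G T (a := 0) (b := T)
  simp only [odd, intervalIntegral.integral_neg, sub_self, sub_zero] at reflect
  linarith

theorem integral_cos_mul_sin_div_one_add_mul_cos (η : ℝ) :
    ∫ ψ in (0 : ℝ)..(2 * π), Real.cos ψ * Real.sin ψ / (1 + η * Real.cos ψ) = 0 :=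
  integral_eq_zero_of_reflection_eq_neg fun ψ => by
    rw [Real.cos_two_pi_sub, Real.sin_two_pi_sub, mul_neg, neg_div]

end TrigIntegrals

/-! ### The Laplacian of the Randers torus -/

section TorusRanders

variable {h η : ℝ}

/-- The Minkowski norm `√g₀ + η h dx` on the plane, the restriction of `torusRanders h η` to each
tangent space. -/
def torusRandersNorm (h η : ℝ) : Plane → ℝ :=
  randersNorm (matrixForm !![h ^ 2, 0; 0, h⁻¹ ^ 2]) (covector ![η * h, 0])

theorem torusRanders_eq (h η : ℝ) : torusRanders h η = fun _ => torusRandersNorm h η := by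
  ext x v
  rw [torusRanders, randers_eq_randersNorm, torusRandersNorm]

theorem dotProduct_diag_mulVec (a b : ℝ) (v w : Plane) :
    v ⬝ᵥ (!![a, 0; 0, b] *ᵥ w) = a * v 0 * w 0 + b * v 1 * w 1 := by
  rw [← Matrix.diagonal_vec2]
  simp only [dotProduct, Matrix.mulVec_diagonal, Fin.sum_univ_two, Matrix.cons_val_zero,
    Matrix.cons_val_one]
  ring

theorem posDef_flatMetric (hh : h ≠ 0) : (!![h ^ 2, 0; 0, h⁻¹ ^ 2] : Matrix _ _ ℝ).PosDef := by
  rw [← Matrix.diagonal_vec2, Matrix.posDef_diagonal_iff, Fin.forall_fin_two]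
  exact ⟨sq_pos_of_ne_zero hh, sq_pos_of_ne_zero (inv_ne_zero hh)⟩

theorem isRandersMetric_torusRanders (hh : h ≠ 0) (hη : |η| < 1) :
    IsRandersMetric (torusRanders h η) := by
  refine ⟨_, _, fun _ _ => contDiff_const, fun _ => contDiff_const,
    fun _ => posDef_flatMetric hh, fun _ => ?_, rfl⟩
  have inverse : (!![h ^ 2, 0; 0, h⁻¹ ^ 2] : Matrix _ _ ℝ)⁻¹ = !![h⁻¹ ^ 2, 0; 0, h ^ 2] :=
    Matrix.inv_eq_right_inv (by simp [Matrix.one_fin_two, hh])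
  have dual_norm_sq : ![η * h, 0] ⬝ᵥ (!![h⁻¹ ^ 2, 0; 0, h ^ 2] *ᵥ ![η * h, 0]) = η ^ 2 := by
    rw [dotProduct_diag_mulVec, Matrix.cons_val_zero, Matrix.cons_val_one, Matrix.cons_val_zero]
    field_simp
    ring
  rwa [inverse, dual_norm_sq, Real.sqrt_sq_eq_abs]

theorem isFinslerMetric_torusRandersNorm (hh : h ≠ 0) (hη : |η| < 1) :
    IsFinslerMetric fun _ => torusRandersNorm h η :=
  torusRanders_eq h η ▸ isFinslerMetric_of_isRandersMetric (isRandersMetric_torusRanders hh hη)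

/-- The unit vector of `g₀ = diag(h², h⁻²)` in the direction of polar angle `ψ` for the
`g₀`-orthonormal frame `(h⁻¹ ∂ₓ, h ∂ᵧ)`. -/
def unitDir (h ψ : ℝ) : Plane := ![h⁻¹ * Real.cos ψ, h * Real.sin ψ]

theorem dir_eq_smul_unitDir (hh : h ≠ 0) (θ : ℝ) :
    dir θ = ‖ellipse h h⁻¹ θ‖ • unitDir h (ellipseAngle h h⁻¹ θ) := by
  have cos_eq := norm_mul_cos_ellipseAngle h h⁻¹ θ
  have sin_eq := norm_mul_sin_ellipseAngle h h⁻¹ θ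
  ext i
  fin_cases i
  · simp [dir, unitDir, mul_left_comm _ h⁻¹, cos_eq, hh]
  · simp [dir, unitDir, mul_left_comm _ h, sin_eq, hh]

theorem torusRandersNorm_unitDir (hh : h ≠ 0) (η ψ : ℝ) :
    torusRandersNorm h η (unitDir h ψ) = 1 + η * Real.cos ψ := by
  have form : matrixForm !![h ^ 2, 0; 0, h⁻¹ ^ 2] (unitDir h ψ) (unitDir h ψ) = 1 := by
    rw [matrixForm_apply, dotProduct_diag_mulVec, ← Real.cos_sq_add_sin_sq ψ]
    simp only [unitDir, Matrix.cons_val_zero, Matrix.cons_val_one]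
    field_simp
  have drift : covector ![η * h, 0] (unitDir h ψ) = η * Real.cos ψ := by
    simp [covector, unitDir, hh, mul_assoc]
  rw [torusRandersNorm, randersNorm, form, drift, Real.sqrt_one]

theorem torusRandersNorm_dir (hh : 0 < h) (θ : ℝ) :
    torusRandersNorm h η (dir θ) =
      ‖ellipse h h⁻¹ θ‖ * (1 + η * Real.cos (ellipseAngle h h⁻¹ θ)) := by
  rw [dir_eq_smul_unitDir hh.ne', torusRandersNorm,
    randersNorm_smul _ _ _ _ (norm_pos_iff.2 (ellipse_ne_zero hh (inv_pos.2 hh) θ)),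
    ← torusRandersNorm, torusRandersNorm_unitDir hh.ne']

theorem angularHessian_torusRandersNorm (hh : h ≠ 0) (η θ : ℝ) :
    angularHessian (torusRandersNorm h η) θ = 1 / ‖ellipse h h⁻¹ θ‖ ^ 3 := by
  set g₀ := matrixForm !![h ^ 2, 0; 0, h⁻¹ ^ 2] with g₀_def
  have pos : 0 < g₀ (dir θ) (dir θ) := matrixForm_pos (posDef_flatMetric hh) (dir_ne_zero θ)
  have coordinates (v w : Plane) : g₀ v w = h ^ 2 * v 0 * w 0 + h⁻¹ ^ 2 * v 1 * w 1 := by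
    rw [g₀_def, matrixForm_apply, dotProduct_diag_mulVec]
  have form_dir : g₀ (dir θ) (dir θ) = ‖ellipse h h⁻¹ θ‖ ^ 2 := by
    rw [norm_ellipse_sq, coordinates]
    simp only [dir, Matrix.cons_val_zero, Matrix.cons_val_one]
    ring
  have gram : g₀ (dir θ) (dir θ) * g₀ (normal θ) (normal θ) - g₀ (dir θ) (normal θ) ^ 2 = 1 := by
    simp only [coordinates, dir, normal, Matrix.cons_val_zero, Matrix.cons_val_one]
    field_simp
    linear_combination h ^ 4 * (Real.cos θ ^ 2 + Real.sin θ ^ 2 + 1) * Real.cos_sq_add_sin_sq θ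
  rw [angularHessian, torusRandersNorm,
    fderiv_fderiv_randersNorm (matrixForm_comm (posDef_flatMetric hh)) _ pos, gram, form_dir,
    Real.sqrt_sq (norm_nonneg _)]

theorem volumeForm_torusRanders (hh : 0 < h) (hη : |η| < 1) (p : Plane) :
    volumeForm (torusRanders h η) p = -1 := by
  have integrand (θ : ℝ) :
      torusRandersNorm h η (dir θ) * angularHessian (torusRandersNorm h η) θ =
        (1 + η * Real.cos (ellipseAngle h h⁻¹ θ)) * (h * h⁻¹ / ‖ellipse h h⁻¹ θ‖ ^ 2) := by
    rw [torusRandersNorm_dir hh, angularHessian_torusRandersNorm hh.ne', mul_inv_cancel₀ hh.ne']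
    field_simp
  rw [torusRanders_eq,
    volumeForm_translationInvariant (isFinslerMetric_torusRandersNorm hh.ne' hη)]
  simp only [integrand]
  rw [integral_comp_ellipseAngle hh (inv_pos.2 hh) (G := fun ψ => 1 + η * Real.cos ψ) (by fun_prop)]
  have mean : ∫ ψ in (0 : ℝ)..(2 * π), (1 + η * Real.cos ψ) = 2 * π := by
    simp [intervalIntegral.integral_add, intervalIntegral.integral_const_mul]
  rw [mean, inv_mul_cancel₀ Real.two_pi_pos.ne']

theorem totalVolume_torusRanders (hh : 0 < h) (hη : |η| < 1) :
    totalVolume (torusRanders h η) = 1 := by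
  simp [totalVolume, volumeForm_torusRanders hh hη, MeasureTheory.measureReal_def,
    Real.volume_Icc_pi]

theorem laplacian_torusRanders_eq_integral (hh : 0 < h) (hη : |η| < 1) {f : T2 → ℝ}
    (hf : ContDiff ℝ 2 fun p => f (proj p)) (p : Plane) :
    laplacian (torusRanders h η) f p =
      π⁻¹ * ∫ ψ in (0 : ℝ)..(2 * π),
        fderiv ℝ (fderiv ℝ fun p => f (proj p)) p (unitDir h ψ) (unitDir h ψ) /
          (1 + η * Real.cos ψ) := by
  have integrand (B : Plane →L[ℝ] Plane →L[ℝ] ℝ) (θ : ℝ) : B (dir θ) (dir θ) *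
      (angularHessian (torusRandersNorm h η) θ / torusRandersNorm h η (dir θ)) =
        (fun ψ => B (unitDir h ψ) (unitDir h ψ) / (1 + η * Real.cos ψ)) (ellipseAngle h h⁻¹ θ) *
          (h * h⁻¹ / ‖ellipse h h⁻¹ θ‖ ^ 2) := by
    rw [torusRandersNorm_dir hh, angularHessian_torusRandersNorm hh.ne', mul_inv_cancel₀ hh.ne',
      dir_eq_smul_unitDir hh.ne']
    simp only [map_smul, smul_apply, smul_eq_mul]
    field_simp
  rw [torusRanders_eq,
    laplacian_translationInvariant (isFinslerMetric_torusRandersNorm hh.ne' hη) hf,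
    ← torusRanders_eq, volumeForm_torusRanders hh hη]
  generalize fderiv ℝ (fderiv ℝ fun p => f (proj p)) p = B
  have continuous_unitDir : Continuous (unitDir h) := by
    unfold unitDir
    fun_prop
  have continuous_integrand :
      Continuous fun ψ => B (unitDir h ψ) (unitDir h ψ) / (1 + η * Real.cos ψ) :=
    continuous_div_one_add_mul_cos hη (by fun_prop)
  rw [intervalIntegral.integral_congr fun θ _ => integrand B θ,
    integral_comp_ellipseAngle hh (inv_pos.2 hh) continuous_integrand, mul_neg_one, inv_neg,
    neg_neg]

theorem bilin_plane_apply_self (B : Plane →L[ℝ] Plane →L[ℝ] ℝ) (w : Plane) :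
    B w w = w 0 ^ 2 * B (Pi.single 0 1) (Pi.single 0 1) +
      w 0 * w 1 * (B (Pi.single 0 1) (Pi.single 1 1) + B (Pi.single 1 1) (Pi.single 0 1)) +
      w 1 ^ 2 * B (Pi.single 1 1) (Pi.single 1 1) := by
  have expand : w = w 0 • Pi.single 0 1 + w 1 • Pi.single 1 1 := by
    ext i
    fin_cases i <;> simp
  conv_lhs => rw [expand]
  simp only [map_add, map_smul, add_apply, smul_apply, smul_eq_mul]
  ring

theorem integral_bilin_unitDir (hη : |η| < 1) (B : Plane →L[ℝ] Plane →L[ℝ] ℝ) :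
    ∫ ψ in (0 : ℝ)..(2 * π), B (unitDir h ψ) (unitDir h ψ) / (1 + η * Real.cos ψ) =
      h⁻¹ ^ 2 * B (Pi.single 0 1) (Pi.single 0 1) *
          (2 * π / (√(1 - η ^ 2) * (1 + √(1 - η ^ 2)))) +
        h ^ 2 * B (Pi.single 1 1) (Pi.single 1 1) * (2 * π / (1 + √(1 - η ^ 2))) := by
  set cross := B (Pi.single 0 1) (Pi.single 1 1) + B (Pi.single 1 1) (Pi.single 0 1)
  have integrand (ψ : ℝ) : B (unitDir h ψ) (unitDir h ψ) / (1 + η * Real.cos ψ) =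
      h⁻¹ ^ 2 * B (Pi.single 0 1) (Pi.single 0 1) * (Real.cos ψ ^ 2 / (1 + η * Real.cos ψ)) +
        h⁻¹ * h * cross * (Real.cos ψ * Real.sin ψ / (1 + η * Real.cos ψ)) +
        h ^ 2 * B (Pi.single 1 1) (Pi.single 1 1) * (Real.sin ψ ^ 2 / (1 + η * Real.cos ψ)) := by
    rw [bilin_plane_apply_self]
    simp only [unitDir, Matrix.cons_val_zero, Matrix.cons_val_one]
    ring
  have integrable {G : ℝ → ℝ} (hG : Continuous G) (c : ℝ) : IntervalIntegrable
      (fun ψ => c * (G ψ / (1 + η * Real.cos ψ))) MeasureTheory.volume 0 (2 * π) :=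
    ((continuous_div_one_add_mul_cos hη hG).intervalIntegrable _ _).const_mul c
  simp only [integrand]
  rw [intervalIntegral.integral_add
      ((integrable (by fun_prop) _).add (integrable (by fun_prop) _)) (integrable (by fun_prop) _),
    intervalIntegral.integral_add (integrable (by fun_prop) _) (integrable (by fun_prop) _)]
  simp only [intervalIntegral.integral_const_mul]
  rw [integral_cos_sq_div_one_add_mul_cos hη, integral_sin_sq_div_one_add_mul_cos hη,
    integral_cos_mul_sin_div_one_add_mul_cos, mul_zero, add_zero]

/-- The Finsler-Laplacian of `F` is the operator `∑ᵢ cᵢ ∂ᵢ²` with constant coefficients `c`. -/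
def HasConstCoeffLaplacian (F : T2 → Plane → ℝ) (c : Fin 2 → ℝ) : Prop :=
  ∀ ⦃f : T2 → ℝ⦄, (ContDiff ℝ 2 fun p => f (proj p)) → ∀ p, laplacian F f p =
    ∑ i, c i * fderiv ℝ (fderiv ℝ fun p => f (proj p)) p (Pi.single i 1) (Pi.single i 1)

/-- The coefficients of the Finsler-Laplacian of `torusRanders h η`. -/
def laplacianCoeff (h η : ℝ) : Fin 2 → ℝ :=
  ![2 / (h ^ 2 * (√(1 - η ^ 2) * (1 + √(1 - η ^ 2)))), 2 * h ^ 2 / (1 + √(1 - η ^ 2))]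

theorem hasConstCoeffLaplacian_torusRanders (hh : 0 < h) (hη : |η| < 1) :
    HasConstCoeffLaplacian (torusRanders h η) (laplacianCoeff h η) := by
  intro f hf p
  rw [laplacian_torusRanders_eq_integral hh hη hf, integral_bilin_unitDir hη, Fin.sum_univ_two]
  simp only [laplacianCoeff, Matrix.cons_val_zero, Matrix.cons_val_one]
  have s_pos : 0 < √(1 - η ^ 2) := Real.sqrt_pos.2 (one_sub_sq_pos hη)
  field_simp

theorem laplacianCoeff_nonneg (h η : ℝ) (i : Fin 2) : 0 ≤ laplacianCoeff h η i := by
  fin_cases i <;> exact div_nonneg (by positivity) (by positivity)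

end TorusRanders

/-! ### The spectrum -/

section Spectrum

/-- The function `cos (2π xᵢ)` on the torus. -/
def cosCoord (i : Fin 2) (x : T2) : ℝ := (fourier 1 (x i)).re

theorem cosCoord_proj (i : Fin 2) (p : Plane) : cosCoord i (proj p) = Real.cos (2 * π * p i) := by
  rw [cosCoord, proj, fourier_coe_apply, ← Complex.exp_ofReal_mul_I_re]
  push_cast
  congr 2
  ring

theorem contDiff_cosCoord (i : Fin 2) {n : ℕ∞ω} : ContDiff ℝ n fun p => cosCoord i (proj p) := by
  simp only [cosCoord_proj]
  fun_prop

theorem fderiv_fderiv_cos_clm {E : Type*} [NormedAddCommGroup E] [NormedSpace ℝ E]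
    (ℓ : E →L[ℝ] ℝ) (v w : E) :
    fderiv ℝ (fderiv ℝ fun u => Real.cos (ℓ u)) v w w = -ℓ w ^ 2 * Real.cos (ℓ v) := by
  have first : (fderiv ℝ fun u => Real.cos (ℓ u)) = fun u => -Real.sin (ℓ u) • ℓ :=
    funext fun u => ℓ.hasFDerivAt.cos.fderiv
  rw [first, (ℓ.hasFDerivAt.sin.fun_neg.smul_const ℓ).fderiv]
  simp only [ContinuousLinearMap.smulRight_apply, neg_apply, smul_apply, smul_eq_mul]
  ring

theorem fderiv_fderiv_cosCoord (i j : Fin 2) (p : Plane) :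
    fderiv ℝ (fderiv ℝ fun p => cosCoord i (proj p)) p (Pi.single j 1) (Pi.single j 1) =
      if j = i then -(4 * π ^ 2) * cosCoord i (proj p) else 0 := by
  have second := fderiv_fderiv_cos_clm
    ((2 * π) • ContinuousLinearMap.proj (R := ℝ) (φ := fun _ => ℝ) i) p (Pi.single j 1)
  simp only [smul_apply, ContinuousLinearMap.proj_apply, smul_eq_mul] at second
  simp only [cosCoord_proj, second]
  split_ifs with hij
  · rw [hij, Pi.single_eq_same]
    ring
  · rw [Pi.single_eq_of_ne' hij]
    ring

theorem linearIndependent_one_cosCoord (i : Fin 2) :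
    LinearIndependent ℝ ![fun _ : T2 => (1 : ℝ), cosCoord i] := by
  rw [LinearIndependent.pair_iff]
  intro a b hab
  have at_zero := congrFun hab (proj 0)
  have at_half := congrFun hab (proj fun _ => 1 / 2)
  have cos_pi : Real.cos (2 * π * (1 / 2)) = -1 := by
    rw [mul_one_div, mul_div_cancel_left₀ π two_ne_zero, Real.cos_pi]
  simp only [Pi.add_apply, Pi.smul_apply, cosCoord_proj, smul_eq_mul, Pi.zero_apply, cos_pi,
    mul_zero, Real.cos_zero] at at_zero at_half
  constructor <;> linarith

theorem not_linearIndependent_of_forall_eq_const {X : Type*} {f : Fin 2 → X → ℝ}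
    (hf : ∀ i, ∃ a, ∀ x, f i x = a) : ¬LinearIndependent ℝ f := by
  choose a ha using hf
  rw [linearIndependent_fin2]
  rintro ⟨ne_zero, not_proportional⟩
  have a_ne : a 1 ≠ 0 := fun a_zero => ne_zero (funext fun x => by rw [ha, a_zero, Pi.zero_apply])
  exact not_proportional (a 0 / a 1) (funext fun x => by
    rw [Pi.smul_apply, ha, ha, smul_eq_mul, div_mul_cancel₀ _ a_ne])

variable {F : T2 → Plane → ℝ} {c : Fin 2 → ℝ}

theorem isEigenfunction_one (hF : HasConstCoeffLaplacian F c) : IsEigenfunction F 0 fun _ => 1 := by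
  refine ⟨contDiff_const, fun eq_zero => one_ne_zero (congrFun eq_zero 0), fun p => ?_⟩
  rw [hF contDiff_const]
  simp

theorem isEigenfunction_cosCoord (hF : HasConstCoeffLaplacian F c) (i : Fin 2) :
    IsEigenfunction F (4 * π ^ 2 * c i) (cosCoord i) := by
  refine ⟨contDiff_cosCoord i, (linearIndependent_one_cosCoord i).ne_zero 1, fun p => ?_⟩
  rw [hF (contDiff_cosCoord i)]
  simp only [fderiv_fderiv_cosCoord, mul_ite, mul_zero, Finset.sum_ite_eq', Finset.mem_univ,
    if_true]
  ring

theorem isKthEigenvalue_one (hc : ∀ i, 0 ≤ c i) (hF : HasConstCoeffLaplacian F c) :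
    IsKthEigenvalue F 1 (4 * π ^ 2 * ⨅ i, c i) := by
  constructor
  · obtain ⟨i, c_eq⟩ := exists_eq_ciInf_of_finite (f := c)
    have eigenvalue_nonneg : 0 ≤ 4 * π ^ 2 * c i := mul_nonneg (by positivity) (hc i)
    rw [← c_eq]
    exact ⟨![fun _ => 1, cosCoord i], linearIndependent_one_cosCoord i, Fin.forall_fin_two.2
      ⟨⟨0, eigenvalue_nonneg, isEigenfunction_one hF⟩,
        ⟨_, le_rfl, isEigenfunction_cosCoord hF i⟩⟩⟩
  · rintro t ⟨f, hli, hf⟩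
    by_contra! ht
    refine not_linearIndependent_of_forall_eq_const (fun k => ?_) hli
    obtain ⟨μ, hμ, smooth, -, heq⟩ := hf k
    refine exists_eq_const_of_eigenvalue_lt_proj (μ := μ) hc (fun i => ?_) smooth fun p => ?_
    · calc
        μ ≤ t := hμ
        _ < 4 * π ^ 2 * ⨅ i, c i := ht
        _ ≤ 4 * π ^ 2 * c i := by
          gcongr
          exact ciInf_le (Set.finite_range c).bddBelow i
    · rw [← hF smooth, heq]

end Spectrum

theorem isKthEigenvalue_torusRanders {h η : ℝ} (hh : 0 < h) (hη : |η| < 1) :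
    IsKthEigenvalue (torusRanders h η) 1 (4 * π ^ 2 * ⨅ i, laplacianCoeff h η i) :=
  isKthEigenvalue_one (laplacianCoeff_nonneg h η) (hasConstCoeffLaplacian_torusRanders hh hη)

theorem sq_le_laplacianCoeff {h η : ℝ} (hh : 0 < h) (hη : |η| < 1)
    (hs : √(1 - η ^ 2) ≤ h⁻¹ ^ 4) (i : Fin 2) : h ^ 2 ≤ laplacianCoeff h η i := by
  have s_pos : 0 < √(1 - η ^ 2) := Real.sqrt_pos.2 (one_sub_sq_pos hη)
  have one_add_s_le : 1 + √(1 - η ^ 2) ≤ 2 := by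
    linarith [Real.sqrt_le_one.2 (sub_le_self 1 (sq_nonneg η))]
  fin_cases i
  · refine (le_div_iff₀ (by positivity)).2 ?_
    calc
      h ^ 2 * (h ^ 2 * (√(1 - η ^ 2) * (1 + √(1 - η ^ 2)))) ≤ h ^ 2 * (h ^ 2 * (h⁻¹ ^ 4 * 2)) := by
        gcongr
      _ = 2 := by field_simp
  · refine (le_div_iff₀ (by positivity)).2 ?_
    calc
      h ^ 2 * (1 + √(1 - η ^ 2)) ≤ h ^ 2 * 2 := by gcongr
      _ = 2 * h ^ 2 := mul_comm _ _

theorem exists_forall_lt_abs_sqrt_one_sub_sq_le {ε : ℝ} (hε : 0 < ε) :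
    ∃ η₀ < 1, ∀ η, η₀ < |η| → √(1 - η ^ 2) ≤ ε := by
  refine ⟨√(1 - ε ^ 2), ?_, fun η hη => ?_⟩
  · rw [Real.sqrt_lt' one_pos, one_pow]
    exact sub_lt_self 1 (pow_pos hε 2)
  · rw [Real.sqrt_lt' ((Real.sqrt_nonneg _).trans_lt hη), sq_abs] at hη
    exact Real.sqrt_le_iff.2 ⟨hε.le, by linarith⟩

end FinslerTorus

end

theorem mainTheorem8_general {h : ℝ} (hh : 0 < h) :
    (∀ η : ℝ, |η| < 1 →
      FinslerTorus.IsRandersMetric (FinslerTorus.torusRanders h η) ∧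
      FinslerTorus.IsFinslerMetric (FinslerTorus.torusRanders h η) ∧
      FinslerTorus.totalVolume (FinslerTorus.torusRanders h η) = 1) ∧
    ∃ η₀ : ℝ, η₀ < 1 ∧ ∀ η : ℝ, η₀ < |η| → |η| < 1 →
      ∃ lam : ℝ, FinslerTorus.IsKthEigenvalue (FinslerTorus.torusRanders h η) 1 lam ∧
        4 * Real.pi ^ 2 * h ^ 2 ≤ lam := by
  open FinslerTorus in
  constructor
  · intro η hη
    have isRanders := isRandersMetric_torusRanders hh.ne' hη
    exact ⟨isRanders, isFinslerMetric_of_isRandersMetric isRanders, totalVolume_torusRanders hh hη⟩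
  · obtain ⟨η₀, η₀_lt, hη₀⟩ :=
      exists_forall_lt_abs_sqrt_one_sub_sq_le (ε := h⁻¹ ^ 4) (by positivity)
    refine ⟨η₀, η₀_lt, fun η hη hη1 => ⟨_, isKthEigenvalue_torusRanders hh hη1, ?_⟩⟩
    gcongr
    exact le_ciInf (sq_le_laplacianCoeff hh hη1 (hη₀ η hη))

theorem mainTheorem8 (h : ℝ) (hh : 1 < h) :
    (∀ η : ℝ, 0 ≤ η → η < 1 →
      FinslerTorus.IsRandersMetric (FinslerTorus.torusRanders h η) ∧
      FinslerTorus.IsFinslerMetric (FinslerTorus.torusRanders h η) ∧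
      FinslerTorus.totalVolume (FinslerTorus.torusRanders h η) = 1) ∧
    ∃ η₀ : ℝ, η₀ < 1 ∧ ∀ η : ℝ, 0 ≤ η → η₀ < η → η < 1 →
      ∃ lam : ℝ, FinslerTorus.IsKthEigenvalue (FinslerTorus.torusRanders h η) 1 lam ∧
        4 * Real.pi ^ 2 * h ^ 2 ≤ lam := by
  obtain ⟨metric, η₀, hη₀, eigenvalue⟩ := mainTheorem8_general (one_pos.trans hh)
  exact ⟨fun η hη hη1 => metric η (by rwa [abs_of_nonneg hη]), η₀, hη₀, fun η hη hη_gt hη1 =>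
    eigenvalue η (by rwa [abs_of_nonneg hη]) (by rwa [abs_of_nonneg hη])⟩
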